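/- Let $n\ge 2$, let $\omega$ be the surface measure on the unit sphere $\mathbb S^{n-1}\subset\mathbb R^n$, and let $$\alpha_n=\sup\{\omega(A)/\omega(\mathbb S^{n-1}) : A\subseteq \mathbb S^{n-1}\ \text{measurable},\ \langle a,a'\rangle\neq 0\ \text{for all } a,a'\in A\}.$$ For $k\ge 0$ let $P_k$ be the Gegenbauer polynomial $C_k^{(n-2)/2}$ of index $(n-2)/2$ and degree $k$, normalized by $P_k(1)=1$ (for $n=2$ this is understood as the limit, i.e. $P_k$ is the Chebyshev polynomial $T_k$). Let $X=\{x_1,-x_1,\dots,x_N,-x_N\}\subset\mathbb S^{n-1}$ be a finite symmetric set with $|X|=2N$, and put $v_i=\{x_i,-x_i\}$. The orthogonality graph $G_X$ has vertices $v_1,\dots,v_N$, and $v_i,v_j$ are joined by an edge if and only if $\langle x_i,x_j\rangle=0$. For sets of vertices $Y,Z$ write $Y\cong Z$ if there is an orthogonal transformation $T$ of $\mathbb R^n$ with $\{T(v):v\in Y\}=Z$. For even $k$ the polynomial $P_k$ is even, so $P_k(\langle v_i,v_j\rangle):=P_k(\langle x_i,x_j\rangle)$ is well defined. Suppose that real numbers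 $q_1$, $w_0$, $w_{i,j}$ ($1\le i\le j\le N$) and $s_{Y,Z}$ (for all ordered pairs of vertex sets with $Y\cong Z$) satisfy $$w_0P_k(0)+\sum_{1\le i\le j\le N}w_{i,j}P_k(\langle v_i,v_j\rangle)\ge 1\qquad\text{for every even } k\ge 0,$$ and $$q_1-\sum_{\substack{i\le j\\ v_i,v_j\in I}}w_{i,j}+\sum_{\substack{Y\cong Z\\ Y\subseteq I}}s_{Y,Z}-\sum_{\substack{Y\cong Z\\ Z\subseteq I}}s_{Y,Z}\ge 0\qquad\text{for every independent set } I \text{ of } G_X$$ (including $I=\emptyset$). Then $\alpha_n\le q_1$. -/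

import Mathlib

open MeasureTheory Polynomial
open scoped Classical

noncomputable section

namespace Witsenhausen

/-- The unit sphere of `ℝⁿ`. -/
abbrev Sph (n : ℕ) : Type := Metric.sphere (0 : EuclideanSpace ℝ (Fin n)) 1

/-- The surface measure on the unit sphere of `ℝⁿ`. -/
def surfaceMeasure (n : ℕ) : Measure (Sph n) :=
  (volume : Measure (EuclideanSpace ℝ (Fin n))).toSphere

/-- `A` avoids orthogonality: no two elements of `A` are orthogonal. -/
def AvoidsOrthogonality {n : ℕ} (A : Set (Sph n)) : Prop :=
  ∀ a ∈ A, ∀ b ∈ A, inner ℝ (a : EuclideanSpace ℝ (Fin n)) (b : EuclideanSpace ℝ (Fin n)) ≠ 0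

/-- `α_n`: the supremum of the densities of the (Lebesgue) measurable subsets of the sphere
that avoid orthogonality. -/
def alpha (n : ℕ) : ℝ :=
  sSup {d : ℝ | ∃ A : Set (Sph n), NullMeasurableSet A (surfaceMeasure n) ∧
    AvoidsOrthogonality A ∧
    d = (surfaceMeasure n).real A / (surfaceMeasure n).real Set.univ}

/-- The Gegenbauer polynomial `C_k^{(l)}`, by its recurrence
`k C_k = 2 (k + l - 1) X C_{k-1} - (k + 2 l - 2) C_{k-2}`. -/
def gegenbauer (l : ℝ) : ℕ → ℝ[X]
  | 0 => 1
  | 1 => C (2 * l) * X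
  | k + 2 => C (1 / ((k : ℝ) + 2)) *
      (C (2 * ((k : ℝ) + 1 + l)) * X * gegenbauer l (k + 1)
        - C ((k : ℝ) + 2 * l) * gegenbauer l k)

/-- The Gegenbauer polynomial of index `(n - 2) / 2` and degree `k`, normalized to take the value
`1` at `1`. For `n = 2` (index `0`) the normalized polynomial is, as usual, the limit as the index
tends to `0`, which is the Chebyshev polynomial of the first kind. -/
def gegenbauerP (n k : ℕ) : ℝ[X] :=
  if n = 2 then Chebyshev.T ℝ k
  else C (((gegenbauer (((n : ℝ) - 2) / 2) k).eval 1)⁻¹) * gegenbauer (((n : ℝ) - 2) / 2) k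

/-- The antipodal pair `v_i = {x_i, -x_i}`. -/
def antipodalPair {n N : ℕ} (x : Fin N → Sph n) (i : Fin N) : Set (EuclideanSpace ℝ (Fin n)) :=
  {(x i : EuclideanSpace ℝ (Fin n)), -(x i : EuclideanSpace ℝ (Fin n))}

/-- The orthogonality graph of `X = {x_1, -x_1, …, x_N, -x_N}`. The vertex `i` stands for the
antipodal pair `v_i`. -/
def orthogonalityGraph {n N : ℕ} (x : Fin N → Sph n) : SimpleGraph (Fin N) where
  Adj i j := inner ℝ (x i : EuclideanSpace ℝ (Fin n)) (x j : EuclideanSpace ℝ (Fin n)) = 0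
  symm := ⟨fun i j h => by rw [real_inner_comm]; exact h⟩
  loopless := ⟨fun i h => by
    have h1 : ‖(x i : EuclideanSpace ℝ (Fin n))‖ = 1 := norm_eq_of_mem_sphere (x i)
    rw [inner_self_eq_zero.mp h, norm_zero] at h1
    exact zero_ne_one h1⟩

/-- `Y ≅ Z`: some orthogonal transformation of `ℝⁿ` maps the set of antipodal pairs `Y` onto
the set of antipodal pairs `Z`. -/
def GeomCongruent {n N : ℕ} (x : Fin N → Sph n) (Y Z : Finset (Fin N)) : Prop :=
  ∃ T : EuclideanSpace ℝ (Fin n) ≃ₗᵢ[ℝ] EuclideanSpace ℝ (Fin n),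
    (fun i => T '' antipodalPair x i) '' (Y : Set (Fin N)) = antipodalPair x '' (Z : Set (Fin N))

end Witsenhausen

end

/-! Let `A` be a measurable symmetric set avoiding orthogonality and let f(x, y) be the probability
that a Haar-random rotation g moves both x and y into `A` (`autocorrelation`). Then f depends only
on ⟨x, y⟩, equals the density of `A` for x = y, and vanishes for orthogonal x, y. The sum of the
w_{i,j} f(x_i, x_j) is bounded from both sides.

Above by q₁ (`sum_mul_autocorrelation_le`): for every g the indices i with g x_i ∈ A form an
independent set. In the average over g of its inequality the s-terms cancel, since congruent vertex
sets are moved into `A` with equal probability.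

Below by the density of `A` (`autocorrelation_self_le`): f is a uniform limit of nonnegative
combinations of the P_k(⟨x, y⟩) with k even, so the polynomial inequalities transfer to f. The
w₀-term contributes nothing, as f is zero on orthogonal pairs.

The expansion of f rests on the Gegenbauer differential equation. Averaging over rotations commutes
with the spherical Laplacian, so the average of P_k(⟨gx, a⟩) h(gy) is a polynomial solution in ⟨x,
y⟩, hence a multiple of P_k (`integral_gegenbauerP_rot`). This yields orthogonality of different
degrees and a diagonal autocorrelation formula for sums of zonal functions. Such sums are dense by
Stone–Weierstrass (`iSup_zonalSpan_topologicalClosure`), and L² approximation reaches the indicator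
of `A`. -/

noncomputable section

namespace Witsenhausen

/-! ### Gegenbauer polynomials and their differential equation -/

/-- The differential equation `(1 - t²) p'' - (n - 1) t p' = -k (k + n - 2) p` of the Gegenbauer
polynomials of index `(n - 2) / 2`. -/
def GegenbauerODE (n k : ℕ) (p : ℝ[X]) : Prop :=
  (1 - X ^ 2) * derivative (derivative p) - C ((n : ℝ) - 1) * X * derivative p
    = -C ((k : ℝ) * ((k : ℝ) + (n : ℝ) - 2)) * p

theorem gegenbauer_succ_succ (l : ℝ) (k : ℕ) :
    C ((k : ℝ) + 2) * gegenbauer l (k + 2) =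
      C (2 * ((k : ℝ) + 1 + l)) * X * gegenbauer l (k + 1)
        - C ((k : ℝ) + 2 * l) * gegenbauer l k := by
  rw [gegenbauer, ← mul_assoc, ← C_mul, mul_one_div_cancel (by positivity), C_1, one_mul]

/-- The two first-order relations need a joint induction. The first at k + 1 is the second at k with
C_k eliminated by the recurrence; the second at k + 1 comes from differentiating the recurrence and
inserting both relations at k. -/
theorem gegenbauer_derivative_aux (l : ℝ) (k : ℕ) :
    (1 - X ^ 2) * derivative (gegenbauer l k) =
        C ((k : ℝ) + 2 * l) * X * gegenbauer l k - C ((k : ℝ) + 1) * gegenbauer l (k + 1) ∧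
      (1 - X ^ 2) * derivative (gegenbauer l (k + 1)) =
        C ((k : ℝ) + 2 * l) * gegenbauer l k - C ((k : ℝ) + 1) * X * gegenbauer l (k + 1) := by
  induction k with
  | zero =>
    constructor
    · simp [gegenbauer]
    · simp [gegenbauer]; ring
  | succ k ih =>
    obtain ⟨h1, h2⟩ := ih
    have hr := gegenbauer_succ_succ l k
    have hd := congrArg derivative hr
    simp only [derivative_mul, derivative_sub, derivative_C, derivative_X, zero_mul, zero_add,
      mul_one] at hd
    have hB : (1 - X ^ 2) * derivative (gegenbauer l (k + 1)) =
        C (((k + 1 : ℕ) : ℝ) + 2 * l) * X * gegenbauer l (k + 1)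
          - C (((k + 1 : ℕ) : ℝ) + 1) * gegenbauer l (k + 2) := by
      push_cast
      simp only [C_add, C_mul, C_1, C_ofNat] at hr h2 ⊢
      linear_combination h2 + hr
    refine ⟨hB, ?_⟩
    have h0 : (C ((k : ℝ) + 2) : ℝ[X]) ≠ 0 := by
      rw [Ne, C_eq_zero]; positivity
    apply mul_left_cancel₀ h0
    push_cast at hB ⊢
    simp only [C_add, C_mul, C_1, C_ofNat] at hr h2 h1 hd hB ⊢
    linear_combination (1 - X ^ 2) * hd + (2 * (C (k : ℝ) + 1 + C l)) * X * h2
      - (C (k : ℝ) + 2 * C l) * h1 + (C (k : ℝ) + 2) * X * hr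

/-- Differentiate the second first-order relation, eliminate the remaining first derivatives with
both relations, and cancel the factor 1 - X². -/
theorem gegenbauer_ode (n k : ℕ) : GegenbauerODE n k (gegenbauer (((n : ℝ) - 2) / 2) k) := by
  unfold GegenbauerODE
  set l : ℝ := ((n : ℝ) - 2) / 2 with hl
  have hn : (n : ℝ) = 2 * l + 2 := by rw [hl]; ring
  rw [hn]
  rcases k with _ | k
  · simp [gegenbauer]
  · obtain ⟨h1, h2⟩ := gegenbauer_derivative_aux l k
    have hd := congrArg derivative h2
    simp only [derivative_mul, derivative_sub, derivative_C, derivative_X, zero_mul, zero_add,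
      mul_one, derivative_one, derivative_X_pow] at hd
    have h0 : (1 - X ^ 2 : ℝ[X]) ≠ 0 := by
      intro h
      have := congrArg (eval 0) h
      simp at this
    apply mul_left_cancel₀ h0
    push_cast at hd ⊢
    simp only [C_add, C_sub, C_mul, C_1, C_ofNat] at h1 h2 hd ⊢
    linear_combination (1 - X ^ 2) * hd + (C (k : ℝ) + 2 * C l) * h1
      - (C (k : ℝ) + 1 + (2 * C l - 1)) * X * h2

theorem gegenbauer_eval_one_pos {l : ℝ} (hl : 0 < l) (k : ℕ) :
    0 < (gegenbauer l k).eval 1 := by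
  have key : ∀ k : ℕ, ((k : ℝ) + 1) * (gegenbauer l (k + 1)).eval 1 =
      ((k : ℝ) + 2 * l) * (gegenbauer l k).eval 1 := by
    intro k
    induction k with
    | zero => simp [gegenbauer]
    | succ k ih =>
      have hr := congrArg (eval 1) (gegenbauer_succ_succ l k)
      simp only [eval_mul, eval_sub, eval_C, eval_X] at hr
      push_cast
      linear_combination hr + ih
  induction k with
  | zero => simp [gegenbauer]
  | succ k ih =>
    have h := key k
    have : 0 < ((k : ℝ) + 2 * l) * (gegenbauer l k).eval 1 := by positivity
    rw [← h] at this
    exact pos_of_mul_pos_right this (by positivity)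

theorem gegenbauerP_eval_one {n : ℕ} (hn : 2 ≤ n) (k : ℕ) : (gegenbauerP n k).eval 1 = 1 := by
  unfold gegenbauerP
  split_ifs with h
  · simp
  · have hl : 0 < ((n : ℝ) - 2) / 2 := by
      have : (2 : ℝ) < n := by exact_mod_cast lt_of_le_of_ne hn (Ne.symm h)
      linarith
    rw [eval_mul, eval_C, inv_mul_cancel₀ (gegenbauer_eval_one_pos hl k).ne']

theorem gegenbauerP_ne_zero {n : ℕ} (hn : 2 ≤ n) (k : ℕ) : gegenbauerP n k ≠ 0 := by
  intro h
  simpa [h] using gegenbauerP_eval_one hn k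

theorem GegenbauerODE.C_mul {n k : ℕ} {p : ℝ[X]} (h : GegenbauerODE n k p) (c : ℝ) :
    GegenbauerODE n k (C c * p) := by
  unfold GegenbauerODE at *
  simp only [derivative_mul, derivative_C, zero_mul, zero_add]
  linear_combination C c * h

theorem GegenbauerODE.sub {n k : ℕ} {p q : ℝ[X]} (hp : GegenbauerODE n k p)
    (hq : GegenbauerODE n k q) : GegenbauerODE n k (p - q) := by
  unfold GegenbauerODE at *
  simp only [derivative_sub]
  linear_combination hp - hq

theorem gegenbauerP_ode (n k : ℕ) : GegenbauerODE n k (gegenbauerP n k) := by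
  unfold gegenbauerP
  split_ifs with h
  · subst h
    have h1 := Chebyshev.one_sub_X_sq_mul_derivative_derivative_T_eq_poly_in_T (R := ℝ) k
    unfold GegenbauerODE
    simp only [Function.iterate_succ, Function.iterate_zero, Function.comp, id] at h1
    rw [h1]
    push_cast
    simp only [map_sub, map_add, map_mul, map_natCast, C_ofNat, map_one]
    ring
  · exact (gegenbauer_ode n k).C_mul _

/-- Comparing leading coefficients in degree m gives the indicial equation (m - k)(m + k + n - 2) =
0. -/
theorem GegenbauerODE.natDegree_eq {n k : ℕ} (hn : 2 ≤ n) {p : ℝ[X]} (h : GegenbauerODE n k p)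
    (hp : p ≠ 0) : p.natDegree = k := by
  have hc := congrArg (fun q => q.coeff p.natDegree) h
  set m := p.natDegree with hm
  have hlead : p.coeff m ≠ 0 := by rw [hm]; exact leadingCoeff_ne_zero.mpr hp
  have e1 : (derivative (derivative p)).coeff m = 0 := by
    rw [coeff_derivative, coeff_derivative, coeff_eq_zero_of_natDegree_lt (by omega)]
    simp
  have e2 : (X ^ 2 * derivative (derivative p)).coeff m = (m : ℝ) * (m - 1) * p.coeff m := by
    rcases Nat.lt_or_ge m 2 with h2 | h2
    · rw [coeff_X_pow_mul', if_neg (by omega)]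
      interval_cases m <;> simp
    · obtain ⟨j, hj⟩ := Nat.exists_eq_add_of_le h2
      rw [hj, add_comm 2 j, coeff_X_pow_mul, coeff_derivative, coeff_derivative]
      push_cast; ring
  have e3 : (X * derivative p).coeff m = (m : ℝ) * p.coeff m := by
    rcases m with _ | j
    · simp
    · rw [coeff_X_mul, coeff_derivative]; push_cast; ring
  simp only [sub_mul, one_mul, coeff_sub, e1, e2, mul_assoc, coeff_C_mul, e3, neg_mul,
    coeff_neg] at hc
  have h3 : ((m : ℝ) - k) * (m + k + n - 2) = 0 := by
    apply mul_right_cancel₀ hlead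
    linear_combination -hc
  have hn' : (2 : ℝ) ≤ n := by exact_mod_cast hn
  have hm0 : (0 : ℝ) ≤ m := by positivity
  have hk0 : (0 : ℝ) ≤ k := by positivity
  rcases mul_eq_zero.mp h3 with h4 | h4
  · exact_mod_cast sub_eq_zero.mp h4
  -- The second factor can vanish only for n = 2 and m = k = 0.
  · have : (m : ℝ) = k := by linarith
    exact_mod_cast this

theorem gegenbauerP_natDegree {n : ℕ} (hn : 2 ≤ n) (k : ℕ) : (gegenbauerP n k).natDegree = k :=
  (gegenbauerP_ode n k).natDegree_eq hn (gegenbauerP_ne_zero hn k)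

theorem gegenbauerP_coeff_ne_zero {n : ℕ} (hn : 2 ≤ n) (k : ℕ) :
    (gegenbauerP n k).coeff k ≠ 0 := by
  have := leadingCoeff_ne_zero.mpr (gegenbauerP_ne_zero hn k)
  rwa [leadingCoeff, gegenbauerP_natDegree hn] at this

/-- Polynomial solutions form a line: the difference of the two sides solves the equation but has no
term of degree k, so it cannot have degree k and must be zero. -/
theorem GegenbauerODE.coeff_mul_eq {n k : ℕ} (hn : 2 ≤ n) {p q : ℝ[X]} (hp : GegenbauerODE n k p)
    (hq : GegenbauerODE n k q) : C (q.coeff k) * p = C (p.coeff k) * q := by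
  by_contra hne
  have hd := (hp.C_mul (q.coeff k)).sub (hq.C_mul (p.coeff k))
  have hne' := sub_ne_zero.mpr hne
  have h1 := leadingCoeff_ne_zero.mpr hne'
  rw [leadingCoeff, hd.natDegree_eq hn hne'] at h1
  apply h1
  simp [mul_comm]

theorem GegenbauerODE.eq_eval_one_mul {n k : ℕ} (hn : 2 ≤ n) {p : ℝ[X]}
    (hp : GegenbauerODE n k p) : p = C (p.eval 1) * gegenbauerP n k := by
  have h := hp.coeff_mul_eq hn (gegenbauerP_ode n k)
  have h0 := gegenbauerP_coeff_ne_zero hn k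
  have h1 := congrArg (eval 1) h
  simp only [eval_mul, eval_C, gegenbauerP_eval_one hn, mul_one] at h1
  apply mul_left_cancel₀ (C_ne_zero.mpr h0)
  rw [h, ← h1, Polynomial.C_mul, mul_assoc]

/-- The equation is invariant under t ↦ -t, so P_k(-X) is a multiple of P_k; the leading
coefficients give the sign. -/
theorem gegenbauerP_eval_neg {n : ℕ} (hn : 2 ≤ n) (k : ℕ) (t : ℝ) :
    (gegenbauerP n k).eval (-t) = (-1) ^ k * (gegenbauerP n k).eval t := by
  set p := gegenbauerP n k with hp
  have h0 := gegenbauerP_coeff_ne_zero hn k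
  have hode : GegenbauerODE n k (p.comp (-X)) := by
    have h := gegenbauerP_ode n k
    unfold GegenbauerODE at *
    have hd : derivative (p.comp (-X)) = -(derivative p).comp (-X) := by
      simp [derivative_comp]
    have hd2 : derivative (derivative (p.comp (-X))) = (derivative (derivative p)).comp (-X) := by
      simp [derivative_comp]
    rw [hd2, hd]
    have := congrArg (fun q => q.comp (-X)) h
    simp only [sub_comp, mul_comp, neg_comp, C_comp, X_comp, one_comp, pow_comp] at this
    linear_combination this
  have h := hode.coeff_mul_eq hn (gegenbauerP_ode n k)
  have hX : (-X : ℝ[X]) = C (-1) * X := by simp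
  rw [hX, comp_C_mul_X_coeff, ← hX] at h
  have h2 := congrArg (eval t) h
  simp only [eval_mul, eval_C, eval_comp, eval_neg, eval_X] at h2
  apply mul_left_cancel₀ h0
  linear_combination h2

theorem mem_span_gegenbauerP {n : ℕ} (hn : 2 ≤ n) (p : ℝ[X]) :
    p ∈ Submodule.span ℝ (Set.range (gegenbauerP n)) := by
  induction hd : p.natDegree using Nat.strong_induction_on generalizing p with
  | _ m ih =>
    subst hd
    set P := gegenbauerP n p.natDegree with hP
    have h0 : P.coeff p.natDegree ≠ 0 := gegenbauerP_coeff_ne_zero hn _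
    have hdeg : P.natDegree = p.natDegree := gegenbauerP_natDegree hn _
    set c := p.coeff p.natDegree / P.coeff p.natDegree
    set q := p - c • P with hq
    have hmem : c • P ∈ Submodule.span ℝ (Set.range (gegenbauerP n)) :=
      Submodule.smul_mem _ _ (Submodule.subset_span ⟨_, rfl⟩)
    have hpq : p = q + c • P := by rw [hq]; ring
    rw [hpq]
    refine Submodule.add_mem _ ?_ hmem
    have hqc : q.coeff p.natDegree = 0 := by
      simp [hq, c, h0]
    have hqd : q.natDegree ≤ p.natDegree := by
      refine (natDegree_sub_le _ _).trans (max_le le_rfl ?_)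
      exact (natDegree_smul_le _ _).trans hdeg.le
    by_cases hq0 : q = 0
    · rw [hq0]; exact Submodule.zero_mem _
    · refine ih q.natDegree ?_ q rfl
      refine lt_of_le_of_ne hqd fun he => hq0 ?_
      rw [← leadingCoeff_eq_zero, leadingCoeff, he, hqc]

/-! ### The orthogonal group, its Haar measure and its action on the sphere -/

theorem isTopologicalGroup_unitary (H : Type*) [NormedAddCommGroup H] [InnerProductSpace ℝ H]
    [CompleteSpace H] : IsTopologicalGroup (unitary (H →L[ℝ] H)) := inferInstance

theorem isClosed_unitary_clm (H : Type*) [NormedAddCommGroup H] [InnerProductSpace ℝ H]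
    [CompleteSpace H] : IsClosed (unitary (H →L[ℝ] H) : Set (H →L[ℝ] H)) := isClosed_unitary

/-- The orthogonal group of `ℝⁿ`. -/
abbrev OrthGroup (n : ℕ) : Type :=
  unitary (EuclideanSpace ℝ (Fin n) →L[ℝ] EuclideanSpace ℝ (Fin n))

instance (n : ℕ) : IsTopologicalGroup (OrthGroup n) :=
  isTopologicalGroup_unitary (EuclideanSpace ℝ (Fin n))

instance (n : ℕ) : MeasurableSpace (OrthGroup n) := borel _

instance (n : ℕ) : BorelSpace (OrthGroup n) := ⟨rfl⟩

instance (n : ℕ) : CompactSpace (OrthGroup n) := by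
  refine isCompact_iff_compactSpace.mp ?_
  refine Metric.isCompact_of_isClosed_isBounded (isClosed_unitary_clm _) ?_
  refine (Metric.isBounded_closedBall (x := (0 : EuclideanSpace ℝ (Fin n) →L[ℝ] _))
    (r := 1)).subset fun g hg => ?_
  rw [mem_closedBall_zero_iff]
  refine ContinuousLinearMap.opNorm_le_bound _ zero_le_one fun x => ?_
  rw [one_mul]
  exact (Unitary.norm_map ⟨g, hg⟩ x).le

/-- The Haar probability measure on the orthogonal group. -/
def haarProb (n : ℕ) : Measure (OrthGroup n) :=
  Measure.haarMeasure ⊤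

instance (n : ℕ) : (haarProb n).IsHaarMeasure := by
  unfold haarProb; infer_instance

instance (n : ℕ) : IsProbabilityMeasure (haarProb n) :=
  ⟨by
    simpa [haarProb] using
      Measure.haarMeasure_self (K₀ := (⊤ : TopologicalSpace.PositiveCompacts (OrthGroup n)))⟩

/-- Compact groups are unimodular: a right translate of the measure is again left invariant, hence a
multiple of it, and the total mass forces the factor 1. -/
instance (n : ℕ) : (haarProb n).IsMulRightInvariant := by
  refine ⟨fun g => ?_⟩
  have h := Measure.isMulInvariant_eq_smul_of_compactSpace ((haarProb n).map (· * g)) (haarProb n)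
  have hu := congrArg (fun m : Measure (OrthGroup n) => m Set.univ) h
  simp only [Measure.map_apply (measurable_mul_const g) MeasurableSet.univ, Set.preimage_univ,
    Measure.smul_apply, measure_univ] at hu
  rw [h]
  have hc : Measure.haarScalarFactor ((haarProb n).map (· * g)) (haarProb n) = 1 := by
    have : ((Measure.haarScalarFactor ((haarProb n).map (· * g)) (haarProb n) : NNReal) :
        ENNReal) = 1 := by
      rw [hu, ENNReal.smul_def, smul_eq_mul, mul_one]
    exact_mod_cast this
  rw [hc, one_smul]

/-- The action of the orthogonal group on the sphere. -/
def rot {n : ℕ} (g : OrthGroup n) (x : Sph n) : Sph n :=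
  ⟨(g : EuclideanSpace ℝ (Fin n) →L[ℝ] EuclideanSpace ℝ (Fin n)) x, by
    rw [mem_sphere_zero_iff_norm, Unitary.norm_map, norm_eq_of_mem_sphere]⟩

@[simp]
theorem coe_rot {n : ℕ} (g : OrthGroup n) (x : Sph n) :
    (rot g x : EuclideanSpace ℝ (Fin n)) =
      (g : EuclideanSpace ℝ (Fin n) →L[ℝ] EuclideanSpace ℝ (Fin n)) x := rfl

theorem rot_mul {n : ℕ} (g h : OrthGroup n) (x : Sph n) : rot (g * h) x = rot g (rot h x) := rfl

theorem rot_neg {n : ℕ} (g : OrthGroup n) (x : Sph n) : rot g (-x) = -rot g x :=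
  Subtype.ext (map_neg (g : EuclideanSpace ℝ (Fin n) →L[ℝ] EuclideanSpace ℝ (Fin n)) _)

theorem inner_rot_rot {n : ℕ} (g : OrthGroup n) (x y : Sph n) :
    inner ℝ (rot g x : EuclideanSpace ℝ (Fin n)) (rot g y : EuclideanSpace ℝ (Fin n)) =
      inner ℝ (x : EuclideanSpace ℝ (Fin n)) (y : EuclideanSpace ℝ (Fin n)) :=
  Unitary.inner_map_map g _ _

theorem continuous_rot {n : ℕ} : Continuous fun p : OrthGroup n × Sph n => rot p.1 p.2 :=
  Continuous.subtype_mk ((continuous_subtype_val.comp continuous_fst).clm_apply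
    (continuous_subtype_val.comp continuous_snd)) _

theorem continuous_rot_left {n : ℕ} (x : Sph n) : Continuous fun g : OrthGroup n => rot g x :=
  continuous_rot.comp (by fun_prop : Continuous fun g : OrthGroup n => (g, x))

theorem continuous_rot_right {n : ℕ} (g : OrthGroup n) : Continuous (rot g) :=
  continuous_rot.comp (by fun_prop : Continuous fun x : Sph n => (g, x))

/-- The orthogonal group acts transitively on pairs of points with a given inner product. -/
theorem exists_rot_eq_and_eq {n : ℕ} {x y x' y' : Sph n}
    (h : inner ℝ (x : EuclideanSpace ℝ (Fin n)) (y : EuclideanSpace ℝ (Fin n)) =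
      inner ℝ (x' : EuclideanSpace ℝ (Fin n)) (y' : EuclideanSpace ℝ (Fin n))) :
    ∃ g : OrthGroup n, rot g x = x' ∧ rot g y = y' := by
  have hnorm : ∀ z : Sph n, ‖(z : EuclideanSpace ℝ (Fin n))‖ = 1 := fun z => norm_eq_of_mem_sphere z
  -- One reflection takes y to y'. A second takes the image of x to x', and it fixes y' because the
  -- two inner products agree.
  set T₁ := (Submodule.span ℝ {(y - y' : EuclideanSpace ℝ (Fin n))})ᗮ.reflection with hT₁
  have h₁ : T₁ (y : EuclideanSpace ℝ (Fin n)) = y' :=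
    Submodule.reflection_sub ((hnorm y).trans (hnorm y').symm)
  set z : EuclideanSpace ℝ (Fin n) := T₁ x with hz
  set T₂ := (Submodule.span ℝ {(z - x' : EuclideanSpace ℝ (Fin n))})ᗮ.reflection with hT₂
  have h₂ : T₂ z = x' := by
    refine Submodule.reflection_sub ?_
    rw [hz, LinearIsometryEquiv.norm_map, hnorm, hnorm]
  have h₃ : T₂ (y' : EuclideanSpace ℝ (Fin n)) = y' := by
    apply Submodule.reflection_mem_subspace_eq_self
    rw [Submodule.mem_orthogonal_singleton_iff_inner_right, inner_sub_left, ← h, hz]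
    nth_rewrite 1 [← h₁]
    rw [LinearIsometryEquiv.inner_map_map, sub_self]
  refine ⟨Unitary.linearIsometryEquiv.symm (T₁.trans T₂), Subtype.ext ?_, Subtype.ext ?_⟩
  · simpa using h₂
  · simpa [h₁] using h₃

theorem exists_rot_eq {n : ℕ} (x x' : Sph n) : ∃ g : OrthGroup n, rot g x = x' := by
  obtain ⟨g, hg, -⟩ := exists_rot_eq_and_eq (x := x) (y := x) (x' := x') (y' := x') (by
    simp)
  exact ⟨g, hg⟩

open scoped Pointwise in
-- `toSphere` measures a set through the Lebesgue measure of the cone over it, and linear isometries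
-- preserve both cones and Lebesgue measure.
theorem surfaceMeasure_preimage_rot {n : ℕ} (g : OrthGroup n) {A : Set (Sph n)}
    (hA : MeasurableSet A) :
    surfaceMeasure n (rot g ⁻¹' A) = surfaceMeasure n A := by
  unfold surfaceMeasure
  rw [Measure.toSphere_apply' _ hA,
    Measure.toSphere_apply' _ ((continuous_rot_right g).measurable hA)]
  congr 1
  set T := Unitary.linearIsometryEquiv g
  have hT : ∀ z, T z = (g : EuclideanSpace ℝ (Fin n) →L[ℝ] EuclideanSpace ℝ (Fin n)) z :=
    fun z => rfl
  have hpre : Set.Ioo (0 : ℝ) 1 • ((↑) '' (rot g ⁻¹' A) : Set (EuclideanSpace ℝ (Fin n))) =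
      T ⁻¹' (Set.Ioo (0 : ℝ) 1 • ((↑) '' A : Set (EuclideanSpace ℝ (Fin n)))) := by
    ext z
    simp only [Set.mem_smul, Set.mem_preimage, Set.mem_image]
    constructor
    · rintro ⟨r, hr, _, ⟨a, ha, rfl⟩, rfl⟩
      exact ⟨r, hr, _, ⟨rot g a, ha, rfl⟩, by rw [map_smul, hT, coe_rot]⟩
    · rintro ⟨r, hr, _, ⟨a, ha, rfl⟩, h⟩
      refine ⟨r, hr, _, ⟨rot g⁻¹ a, ?_, rfl⟩, ?_⟩
      · rw [← rot_mul, mul_inv_cancel]; exact ha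
      · apply T.injective
        rw [← h, map_smul, hT, ← coe_rot, ← rot_mul, mul_inv_cancel]; rfl
  rw [hpre]
  exact T.measurePreserving.measure_preimage_equiv (f := T.toMeasurableEquiv) _

theorem surfaceMeasure_univ_ne_zero {n : ℕ} (hn : 2 ≤ n) :
    surfaceMeasure n Set.univ ≠ 0 := by
  have : Nontrivial (EuclideanSpace ℝ (Fin n)) := by
    apply Module.nontrivial_of_finrank_pos (R := ℝ)
    rw [finrank_euclideanSpace_fin]; omega
  rw [Ne, Measure.measure_univ_eq_zero]
  exact Measure.toSphere_ne_zero _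

instance (n : ℕ) : IsFiniteMeasure (surfaceMeasure n) := by
  unfold surfaceMeasure; infer_instance

/-- Fubini for {(g, y) | gy ∈ A}: the slices at fixed g have constant measure by invariance of the
surface measure, those at fixed y by transitivity and right invariance. -/
theorem haarProb_mul_surfaceMeasure {n : ℕ} (x : Sph n) {A : Set (Sph n)} (hA : MeasurableSet A) :
    haarProb n {g | rot g x ∈ A} * surfaceMeasure n Set.univ = surfaceMeasure n A := by
  have hconst : ∀ y : Sph n, haarProb n {g | rot g y ∈ A} = haarProb n {g | rot g x ∈ A} := by
    intro y
    obtain ⟨h, rfl⟩ := exists_rot_eq x y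
    have := measure_preimage_mul_right (haarProb n) h {g | rot g x ∈ A}
    exact this
  have hS : MeasurableSet {p : OrthGroup n × Sph n | rot p.1 p.2 ∈ A} :=
    continuous_rot.measurable hA
  have h1 := Measure.prod_apply (μ := haarProb n) (ν := surfaceMeasure n) hS
  have h2 := Measure.prod_apply_symm (μ := haarProb n) (ν := surfaceMeasure n) hS
  rw [h1] at h2
  have e1 : ∀ g : OrthGroup n,
      surfaceMeasure n (Prod.mk g ⁻¹' {p : OrthGroup n × Sph n | rot p.1 p.2 ∈ A})
      = surfaceMeasure n A := fun g => surfaceMeasure_preimage_rot g hA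
  have e2 : ∀ y : Sph n,
      haarProb n ((fun g => (g, y)) ⁻¹' {p : OrthGroup n × Sph n | rot p.1 p.2 ∈ A})
      = haarProb n {g | rot g x ∈ A} := hconst
  simp only [e1, e2, lintegral_const, measure_univ, mul_one] at h2
  exact h2.symm

/-! ### Great circles and averages over rotations -/

/-- The inner product of two points of the sphere. -/
abbrev dot {n : ℕ} (x y : Sph n) : ℝ :=
  inner ℝ (x : EuclideanSpace ℝ (Fin n)) (y : EuclideanSpace ℝ (Fin n))

theorem dot_self {n : ℕ} (x : Sph n) : dot x x = 1 := by
  simp [dot]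

theorem dot_comm {n : ℕ} (x y : Sph n) : dot x y = dot y x := real_inner_comm _ _

theorem continuous_dot_rot {n : ℕ} (x a : Sph n) :
    Continuous fun g : OrthGroup n => dot (rot g x) a :=
  (continuous_subtype_val.comp (continuous_rot_left x)).inner continuous_const

theorem dot_rot_left {n : ℕ} (g : OrthGroup n) (x a : Sph n) :
    dot (rot g x) a = dot x (rot g⁻¹ a) := by
  rw [dot, ← inner_rot_rot g⁻¹, ← rot_mul, inv_mul_cancel]; rfl

theorem exists_combination {n : ℕ} {y e : Sph n} (h : dot y e = 0) {α β : ℝ}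
    (hαβ : α ^ 2 + β ^ 2 = 1) :
    ∃ z : Sph n, (z : EuclideanSpace ℝ (Fin n)) =
      α • (y : EuclideanSpace ℝ (Fin n)) + β • (e : EuclideanSpace ℝ (Fin n)) := by
  refine ⟨⟨_, ?_⟩, rfl⟩
  rw [mem_sphere_zero_iff_norm, ← sq_eq_sq₀ (norm_nonneg _) zero_le_one, norm_add_sq_real]
  simp only [norm_smul, real_inner_smul_left, real_inner_smul_right, norm_eq_of_mem_sphere,
    Real.norm_eq_abs]
  rw [show inner ℝ (y : EuclideanSpace ℝ (Fin n)) (e : EuclideanSpace ℝ (Fin n)) = 0 from h]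
  simp [hαβ]

theorem dot_combination {n : ℕ} {y e z : Sph n} {α β : ℝ}
    (hz : (z : EuclideanSpace ℝ (Fin n)) =
      α • (y : EuclideanSpace ℝ (Fin n)) + β • (e : EuclideanSpace ℝ (Fin n))) (a : Sph n) :
    dot z a = α * dot y a + β * dot e a := by
  rw [dot, hz, inner_add_left, real_inner_smul_left, real_inner_smul_left]

theorem dot_rot_combination {n : ℕ} {y e z : Sph n} {α β : ℝ}
    (hz : (z : EuclideanSpace ℝ (Fin n)) =
      α • (y : EuclideanSpace ℝ (Fin n)) + β • (e : EuclideanSpace ℝ (Fin n)))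
    (g : OrthGroup n) (a : Sph n) :
    dot (rot g z) a = α * dot (rot g y) a + β * dot (rot g e) a := by
  simp only [dot_rot_left, dot_combination hz]

theorem exists_orthonormalBasis_zero {n : ℕ} [NeZero n] (x : Sph n) :
    ∃ b : OrthonormalBasis (Fin n) ℝ (EuclideanSpace ℝ (Fin n)), b 0 = x := by
  have hv : Orthonormal ℝ (({0} : Set (Fin n)).domRestrict
      (fun _ : Fin n => (x : EuclideanSpace ℝ (Fin n)))) := by
    constructor
    · intro i; exact norm_eq_of_mem_sphere x
    · intro i j hij; exact absurd (Subsingleton.elim i j) hij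
  obtain ⟨b, hb⟩ := hv.exists_orthonormalBasis_extension_of_card_eq (by simp)
  exact ⟨b, hb 0 rfl⟩

theorem exists_dot_eq_zero {n : ℕ} (hn : 2 ≤ n) (y : Sph n) : ∃ e : Sph n, dot y e = 0 := by
  have : NeZero n := ⟨by omega⟩
  obtain ⟨b, hb⟩ := exists_orthonormalBasis_zero y
  refine ⟨⟨b ⟨1, by omega⟩, by simp⟩, ?_⟩
  rw [dot, ← hb]
  exact b.orthonormal.2 (by simp [Fin.ext_iff])

theorem integral_rot_invariant {n : ℕ} (F : OrthGroup n → ℝ) (g₀ : OrthGroup n) :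
    ∫ g, F (g * g₀) ∂haarProb n = ∫ g, F g ∂haarProb n :=
  integral_mul_right_eq_self F g₀

/-- Averages over the orthogonal group depend on a pair of points only through their inner
product. -/
theorem integral_rot_congr {n : ℕ} (F : Sph n → Sph n → ℝ) {x y x' y' : Sph n}
    (h : dot x y = dot x' y') :
    ∫ g, F (rot g x) (rot g y) ∂haarProb n = ∫ g, F (rot g x') (rot g y') ∂haarProb n := by
  obtain ⟨g₀, rfl, rfl⟩ := exists_rot_eq_and_eq h
  exact (integral_rot_invariant (fun g => F (rot g x) (rot g y)) g₀).symm

/-- Reduction modulo s² = 1 - t² leaves a part free of s and a part linear in s. -/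
theorem exists_even_odd_parts {G : Type*} [TopologicalSpace G] (A B : C(G, ℝ)) (p : ℝ[X]) :
    ∃ U V : C(G, ℝ)[X], ∀ t s : ℝ, s ^ 2 = 1 - t ^ 2 → ∀ g,
      p.eval (t * A g + s * B g) = U.eval (ContinuousMap.const G t) g
        + s * V.eval (ContinuousMap.const G t) g := by
  induction p using Polynomial.induction_on with
  | C c => exact ⟨C (ContinuousMap.const G c), 0, fun t s _ g => by simp⟩
  | add p q hp hq =>
    obtain ⟨U, V, h⟩ := hp
    obtain ⟨U', V', h'⟩ := hq
    refine ⟨U + U', V + V', fun t s hs g => ?_⟩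
    simp only [eval_add, h t s hs g, h' t s hs g, ContinuousMap.add_apply]
    ring
  | monomial m c ih =>
    obtain ⟨U, V, h⟩ := ih
    refine ⟨C A * X * U + C B * (1 - X ^ 2) * V, C A * X * V + C B * U, fun t s hs g => ?_⟩
    rw [pow_succ, ← mul_assoc, eval_mul, h t s hs g]
    simp only [eval_X, eval_add, eval_mul, eval_C, eval_sub, eval_pow, eval_one,
      ContinuousMap.add_apply, ContinuousMap.mul_apply, ContinuousMap.const_apply,
      ContinuousMap.sub_apply, ContinuousMap.one_apply, ContinuousMap.pow_apply]
    linear_combination B g * (V.eval (ContinuousMap.const G t) g) * hs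

theorem integrable_of_continuous_compact {G : Type*} [TopologicalSpace G] [CompactSpace G]
    [MeasurableSpace G] [BorelSpace G] {μ : Measure G} [IsFiniteMeasure μ] {f : G → ℝ}
    (hf : Continuous f) : Integrable f μ := by
  obtain ⟨C, hC⟩ := (isCompact_range hf).isBounded.exists_norm_le
  exact Integrable.of_bound hf.measurable.aestronglyMeasurable C
    (Filter.Eventually.of_forall fun g => hC _ ⟨g, rfl⟩)

/-- Adding the values at s and -s removes the part linear in s; the coefficients of what remains are
integrated one by one. -/
theorem exists_polynomial_average {G : Type*} [TopologicalSpace G] [CompactSpace G]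
    [MeasurableSpace G] [BorelSpace G] (μ : Measure G) [IsFiniteMeasure μ] (A B c : C(G, ℝ))
    (p : ℝ[X]) :
    ∃ φ : ℝ[X], ∀ t s : ℝ, s ^ 2 = 1 - t ^ 2 →
      ∫ g, p.eval (t * A g + s * B g) * c g ∂μ + ∫ g, p.eval (t * A g + (-s) * B g) * c g ∂μ =
        2 * φ.eval t := by
  obtain ⟨U, V, h⟩ := exists_even_odd_parts A B p
  refine ⟨∑ i ∈ Finset.range (U.natDegree + 1), C (∫ g, U.coeff i g * c g ∂μ) * X ^ i,
    fun t s hs => ?_⟩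
  have hp : ∀ s : ℝ, Integrable (fun g => p.eval (t * A g + s * B g) * c g) μ := fun s =>
    integrable_of_continuous_compact (by fun_prop)
  rw [← integral_add (hp s) (hp (-s)), eval_finsetSum, Finset.mul_sum]
  have e : ∀ g, p.eval (t * A g + s * B g) * c g + p.eval (t * A g + (-s) * B g) * c g =
      ∑ i ∈ Finset.range (U.natDegree + 1), 2 * t ^ i * (U.coeff i g * c g) := by
    intro g
    rw [h t s hs g, h t (-s) (by rw [neg_sq, hs]) g]
    have hU : U.eval (ContinuousMap.const G t) g =
        ∑ i ∈ Finset.range (U.natDegree + 1), U.coeff i g * t ^ i := by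
      rw [eval_eq_sum_range]
      simp [ContinuousMap.sum_apply]
    have : ∑ i ∈ Finset.range (U.natDegree + 1), 2 * t ^ i * (U.coeff i g * c g) =
        2 * U.eval (ContinuousMap.const G t) g * c g := by
      rw [hU, Finset.mul_sum, Finset.sum_mul]
      exact Finset.sum_congr rfl fun i _ => by ring
    rw [this]; ring
  simp only [e]
  rw [integral_finsetSum _ fun i _ => (integrable_of_continuous_compact (by fun_prop))]
  refine Finset.sum_congr rfl fun i _ => ?_
  rw [integral_const_mul]
  simp; ring

theorem hasDerivAt_integral_of_continuous {G : Type*} [TopologicalSpace G] [CompactSpace G]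
    [MeasurableSpace G] [BorelSpace G] (μ : Measure G) [IsFiniteMeasure μ] {F F' : ℝ → G → ℝ}
    (hF : ∀ θ, Continuous (F θ)) (hF' : Continuous (Function.uncurry F'))
    (hd : ∀ θ g, HasDerivAt (fun θ => F θ g) (F' θ g) θ) (θ : ℝ) :
    HasDerivAt (fun θ => ∫ g, F θ g ∂μ) (∫ g, F' θ g ∂μ) θ := by
  obtain ⟨K, hK⟩ := ((isCompact_Icc (a := θ - 1) (b := θ + 1)).prod
    (isCompact_univ (X := G))).exists_bound_of_continuousOn hF'.continuousOn
  have hF'θ : Continuous (F' θ) := hF'.comp (by fun_prop : Continuous fun g : G => (θ, g))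
  refine (hasDerivAt_integral_of_dominated_loc_of_deriv_le
    (s := Set.Icc (θ - 1) (θ + 1)) (bound := fun _ => K)
    (Icc_mem_nhds (by linarith) (by linarith))
    (Filter.Eventually.of_forall fun θ => (hF θ).measurable.aestronglyMeasurable)
    (integrable_of_continuous_compact (hF θ)) hF'θ.measurable.aestronglyMeasurable
    (Filter.Eventually.of_forall fun g θ' hθ' => hK (θ', g) ⟨hθ', trivial⟩)
    (integrable_const K) (Filter.Eventually.of_forall fun g θ' _ => hd θ' g)).2

theorem hasDerivAt_eval_circle (p : ℝ[X]) (a b θ : ℝ) :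
    HasDerivAt (fun θ => p.eval (Real.cos θ * a + Real.sin θ * b))
      ((derivative p).eval (Real.cos θ * a + Real.sin θ * b)
        * (-Real.sin θ * a + Real.cos θ * b)) θ :=
  (p.hasDerivAt _).comp θ (((Real.hasDerivAt_cos θ).mul_const a).add
    ((Real.hasDerivAt_sin θ).mul_const b))

theorem hasDerivAt_eval_circle_deriv (p : ℝ[X]) (a b θ : ℝ) :
    HasDerivAt (fun θ => (derivative p).eval (Real.cos θ * a + Real.sin θ * b)
        * (-Real.sin θ * a + Real.cos θ * b))
      ((derivative (derivative p)).eval (Real.cos θ * a + Real.sin θ * b)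
        * (-Real.sin θ * a + Real.cos θ * b) * (-Real.sin θ * a + Real.cos θ * b)
        + (derivative p).eval (Real.cos θ * a + Real.sin θ * b)
          * (-Real.cos θ * a + -Real.sin θ * b)) θ :=
  (hasDerivAt_eval_circle (derivative p) a b θ).mul
    (((Real.hasDerivAt_sin θ).neg.mul_const a).add ((Real.hasDerivAt_cos θ).mul_const b))

/-- Both sides of the hypothesis are differentiated twice in θ and compared at θ = 0. -/
theorem integral_second_derivative_circle {G : Type*} [TopologicalSpace G] [CompactSpace G]
    [MeasurableSpace G] [BorelSpace G] (μ : Measure G) [IsFiniteMeasure μ] (A B c : C(G, ℝ))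
    (p φ : ℝ[X]) (t b : ℝ)
    (h : ∀ θ : ℝ, ∫ g, p.eval (Real.cos θ * A g + Real.sin θ * B g) * c g ∂μ =
      φ.eval (Real.cos θ * t + Real.sin θ * b)) :
    ∫ g, ((derivative (derivative p)).eval (A g) * B g ^ 2
        - (derivative p).eval (A g) * A g) * c g ∂μ =
      (derivative (derivative φ)).eval t * b ^ 2 - (derivative φ).eval t * t := by
  have h1 := hasDerivAt_integral_of_continuous μ
    (F := fun θ g => p.eval (Real.cos θ * A g + Real.sin θ * B g) * c g)
    (F' := fun θ g => (derivative p).eval (Real.cos θ * A g + Real.sin θ * B g)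
        * (-Real.sin θ * A g + Real.cos θ * B g) * c g)
    (fun θ => by fun_prop) (by unfold Function.uncurry; fun_prop)
    (fun θ g => (hasDerivAt_eval_circle p (A g) (B g) θ).mul_const (c g))
  have h2 := hasDerivAt_integral_of_continuous μ
    (F := fun θ g => (derivative p).eval (Real.cos θ * A g + Real.sin θ * B g)
        * (-Real.sin θ * A g + Real.cos θ * B g) * c g)
    (F' := fun θ g => ((derivative (derivative p)).eval (Real.cos θ * A g + Real.sin θ * B g)
        * (-Real.sin θ * A g + Real.cos θ * B g) * (-Real.sin θ * A g + Real.cos θ * B g)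
        + (derivative p).eval (Real.cos θ * A g + Real.sin θ * B g)
          * (-Real.cos θ * A g + -Real.sin θ * B g)) * c g)
    (fun θ => by fun_prop) (by unfold Function.uncurry; fun_prop)
    (fun θ g => (hasDerivAt_eval_circle_deriv p (A g) (B g) θ).mul_const (c g)) 0
  simp only [h] at h1
  have e1 := fun θ => (h1 θ).unique (hasDerivAt_eval_circle φ t b θ)
  simp only [e1] at h2
  have e2 := h2.unique (hasDerivAt_eval_circle_deriv φ t b 0)
  simp only [Real.cos_zero, Real.sin_zero, one_mul, zero_mul, neg_zero, add_zero, zero_add,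
    neg_mul, mul_neg] at e2
  rw [show (derivative (derivative φ)).eval t * b ^ 2 - (derivative φ).eval t * t =
    (derivative (derivative φ)).eval t * b * b + -((derivative φ).eval t * t) by ring, ← e2]
  refine integral_congr_ae (Filter.Eventually.of_forall fun g => ?_)
  ring

/-- The average of a ridge polynomial against a function of `g • y` is a polynomial in the inner
product with `y`. -/
theorem exists_polynomial_integral_rot {n : ℕ} (hn : 2 ≤ n) (p : ℝ[X]) {h : Sph n → ℝ}
    (hh : Continuous h) (a y : Sph n) :
    ∃ φ : ℝ[X], ∀ x : Sph n,
      ∫ g, p.eval (dot (rot g x) a) * h (rot g y) ∂haarProb n = φ.eval (dot x y) := by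
  obtain ⟨e, he⟩ := exists_dot_eq_zero hn y
  obtain ⟨φ, hφ⟩ := exists_polynomial_average (haarProb n)
    ⟨_, continuous_dot_rot y a⟩ ⟨_, continuous_dot_rot e a⟩
    ⟨_, hh.comp (continuous_rot_left y)⟩ p
  refine ⟨φ, fun x => ?_⟩
  have ht : 0 ≤ 1 - dot x y ^ 2 := by
    have h1 := abs_real_inner_le_norm (x : EuclideanSpace ℝ (Fin n)) y
    rw [norm_eq_of_mem_sphere, norm_eq_of_mem_sphere, one_mul] at h1
    have := (sq_le_one_iff_abs_le_one _).mpr h1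
    linarith
  -- The average depends on x only through t = ⟨x, y⟩, so x may be replaced by ty + se with either
  -- sign of s = ±√(1 - t²).
  have key : ∀ s : ℝ, s ^ 2 = 1 - dot x y ^ 2 →
      ∫ g, p.eval (dot (rot g x) a) * h (rot g y) ∂haarProb n =
      ∫ g, p.eval (dot x y * dot (rot g y) a + s * dot (rot g e) a) * h (rot g y) ∂haarProb n := by
    intro s hs
    obtain ⟨z, hz⟩ := exists_combination he (α := dot x y) (β := s) (by linarith)
    have hzy : dot x y = dot z y := by
      rw [dot_combination hz, dot_self, dot_comm e y, he]; ring
    rw [integral_rot_congr (fun u v => p.eval (dot u a) * h v) hzy]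
    simp only [dot_rot_combination hz]
  have hs := Real.sq_sqrt ht
  have h2 := hφ _ _ hs
  simp only [ContinuousMap.coe_mk, Function.comp] at h2
  rw [← key _ hs, ← key _ (by rw [neg_sq, hs])] at h2
  linarith

theorem eq_of_eval_dot_eq {n : ℕ} (hn : 2 ≤ n) {p q : ℝ[X]} (y : Sph n)
    (h : ∀ x : Sph n, p.eval (dot x y) = q.eval (dot x y)) : p = q := by
  refine eq_of_infinite_eval_eq _ _ ((Set.Icc_infinite (show (0 : ℝ) < 1 by norm_num)).mono ?_)
  intro t ht
  obtain ⟨e, he⟩ := exists_dot_eq_zero hn y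
  obtain ⟨x, hx⟩ := exists_combination he (α := t) (β := √(1 - t ^ 2)) (by
    rw [Real.sq_sqrt (by nlinarith [ht.1, ht.2])]; ring)
  have hxy : dot x y = t := by
    rw [dot_combination hx, dot_self, dot_comm e y, he]; ring
  rw [← hxy]
  exact h x

/-- The spherical Laplacian at x is the sum of second derivatives along the great circles from x in
n - 1 orthonormal tangent directions. It acts on p(⟨·, a⟩) as (1 - t²) p'' - (n - 1) t p' and
commutes with the average over g, so the eigenvalue equation passes from p to φ. -/
theorem gegenbauerODE_of_integral_rot {n : ℕ} (hn : 2 ≤ n) {k : ℕ} {p φ : ℝ[X]}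
    (hp : GegenbauerODE n k p) {h : Sph n → ℝ} (hh : Continuous h) (a y : Sph n)
    (hφ : ∀ x : Sph n,
      ∫ g, p.eval (dot (rot g x) a) * h (rot g y) ∂haarProb n = φ.eval (dot x y)) :
    GegenbauerODE n k φ := by
  have : NeZero n := ⟨by omega⟩
  have key : ∀ x : Sph n, ((1 - X ^ 2) * derivative (derivative φ)
      - C ((n : ℝ) - 1) * X * derivative φ).eval (dot x y) =
        (-C ((k : ℝ) * ((k : ℝ) + (n : ℝ) - 2)) * φ).eval (dot x y) := by
    intro x
    obtain ⟨b, hb⟩ := exists_orthonormalBasis_zero x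
    set v : Fin n → Sph n := fun i => ⟨b i, by simp⟩ with hv
    have hv0 : v 0 = x := Subtype.ext hb
    -- Parseval: the squared tangential components of z at x add up to 1 - ⟨x, z⟩².
    have hsum : ∀ z : Sph n, ∑ i ∈ Finset.univ.erase (0 : Fin n), dot (v i) z ^ 2
        = 1 - dot x z ^ 2 := by
      intro z
      have h1 := b.sum_sq_inner_right (z : EuclideanSpace ℝ (Fin n))
      rw [norm_eq_of_mem_sphere, one_pow, ← Finset.add_sum_erase _ _ (Finset.mem_univ 0), hb] at h1
      exact eq_sub_of_add_eq' h1
    have hcard : ((Finset.univ.erase (0 : Fin n)).card : ℝ) = n - 1 := by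
      rw [Finset.card_erase_of_mem (Finset.mem_univ _), Finset.card_univ, Fintype.card_fin,
        Nat.cast_sub (by omega), Nat.cast_one]
    have hi : ∀ i ∈ Finset.univ.erase (0 : Fin n),
        ∫ g, ((derivative (derivative p)).eval (dot (rot g x) a) * dot (rot g (v i)) a ^ 2
          - (derivative p).eval (dot (rot g x) a) * dot (rot g x) a) * h (rot g y) ∂haarProb n =
        (derivative (derivative φ)).eval (dot x y) * dot (v i) y ^ 2
          - (derivative φ).eval (dot x y) * dot x y := by
      intro i hi
      have horth : dot x (v i) = 0 := by
        rw [← hv0]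
        exact b.orthonormal.2 (Finset.ne_of_mem_erase hi).symm
      refine integral_second_derivative_circle (haarProb n)
        ⟨_, continuous_dot_rot x a⟩ ⟨_, continuous_dot_rot (v i) a⟩
        ⟨_, hh.comp (continuous_rot_left y)⟩ p φ (dot x y) (dot (v i) y) fun θ => ?_
      obtain ⟨z, hz⟩ := exists_combination horth (Real.cos_sq_add_sin_sq θ)
      rw [← dot_combination hz, ← hφ z]
      simp only [dot_rot_combination hz]
      rfl
    have hS := Finset.sum_congr rfl hi
    rw [← integral_finsetSum] at hS
    swap
    · intro i _
      refine integrable_of_continuous_compact ?_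
      have hx := continuous_dot_rot x a
      exact (((((derivative (derivative p)).continuous).comp hx).mul
        ((continuous_dot_rot (v i) a).pow 2)).sub
          (((derivative p).continuous.comp hx).mul hx)).mul (hh.comp (continuous_rot_left y))
    have hg : ∀ g : OrthGroup n, ∑ i ∈ Finset.univ.erase (0 : Fin n),
        ((derivative (derivative p)).eval (dot (rot g x) a) * dot (rot g (v i)) a ^ 2
          - (derivative p).eval (dot (rot g x) a) * dot (rot g x) a) * h (rot g y) =
        -((k : ℝ) * ((k : ℝ) + (n : ℝ) - 2)) *
          (p.eval (dot (rot g x) a) * h (rot g y)) := by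
      intro g
      rw [← Finset.sum_mul, Finset.sum_sub_distrib, ← Finset.mul_sum, Finset.sum_const,
        nsmul_eq_mul, hcard]
      simp only [dot_rot_left g, hsum]
      have := congrArg (eval (dot x (rot g⁻¹ a))) hp
      simp only [eval_sub, eval_mul, eval_one, eval_pow, eval_X, eval_C, eval_neg] at this
      linear_combination h (rot g y) * this
    simp only [hg] at hS
    rw [integral_const_mul, hφ x, Finset.sum_sub_distrib, ← Finset.mul_sum, Finset.sum_const,
        nsmul_eq_mul, hcard, hsum] at hS
    simp only [eval_sub, eval_mul, eval_one, eval_pow, eval_X, eval_C, eval_neg]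
    linear_combination -hS
  refine eq_of_eval_dot_eq hn y key

/-- A Funk–Hecke type formula: as a function of ⟨x, y⟩ the average solves the Gegenbauer equation,
so it is a multiple of P_k, and the factor is read off at x = y. -/
theorem integral_gegenbauerP_rot {n : ℕ} (hn : 2 ≤ n) (k : ℕ) {h : Sph n → ℝ}
    (hh : Continuous h) (a x y : Sph n) :
    ∫ g, (gegenbauerP n k).eval (dot (rot g x) a) * h (rot g y) ∂haarProb n =
      (∫ g, (gegenbauerP n k).eval (dot (rot g y) a) * h (rot g y) ∂haarProb n)
        * (gegenbauerP n k).eval (dot x y) := by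
  obtain ⟨φ, hφ⟩ := exists_polynomial_integral_rot hn (gegenbauerP n k) hh a y
  have hode := gegenbauerODE_of_integral_rot hn (gegenbauerP_ode n k) hh a y hφ
  rw [hφ x, hφ y, dot_self, hode.eq_eval_one_mul hn]
  simp [gegenbauerP_eval_one hn]

/-! ### Spherical harmonics: orthogonality and density -/

/-- The ridge function `x ↦ p ⟨x, a⟩` on the sphere. -/
def ridge {n : ℕ} (p : ℝ[X]) (a : Sph n) : C(Sph n, ℝ) :=
  ⟨fun x => p.eval (dot x a), p.continuous.comp (continuous_subtype_val.inner continuous_const)⟩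

/-- The span of the zonal functions `x ↦ P_k ⟨x, a⟩`, that is, the spherical harmonics of
degree `k`. -/
def zonalSpan (n k : ℕ) : Submodule ℝ C(Sph n, ℝ) :=
  Submodule.span ℝ (Set.range (ridge (gegenbauerP n k)))

theorem integrable_rot_mul {n : ℕ} (f h : C(Sph n, ℝ)) (x y : Sph n) :
    Integrable (fun g => f (rot g x) * h (rot g y)) (haarProb n) :=
  integrable_of_continuous_compact ((f.continuous.comp (continuous_rot_left x)).mul
    (h.continuous.comp (continuous_rot_left y)))

theorem integral_zonalSpan_rot {n : ℕ} (hn : 2 ≤ n) {k : ℕ} {f : C(Sph n, ℝ)}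
    (hf : f ∈ zonalSpan n k) (h : C(Sph n, ℝ)) (x y : Sph n) :
    ∫ g, f (rot g x) * h (rot g y) ∂haarProb n =
      (∫ g, f (rot g y) * h (rot g y) ∂haarProb n) * (gegenbauerP n k).eval (dot x y) := by
  induction hf using Submodule.span_induction with
  | mem f hf =>
    obtain ⟨a, rfl⟩ := hf
    exact integral_gegenbauerP_rot hn k h.continuous a x y
  | zero => simp
  | add f f' _ _ hf hf' =>
    simp only [ContinuousMap.add_apply, add_mul]
    rw [integral_add (integrable_rot_mul f h x y) (integrable_rot_mul f' h x y), hf, hf',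
      integral_add (integrable_rot_mul f h y y) (integrable_rot_mul f' h y y), add_mul]
  | smul c f _ hf =>
    simp only [ContinuousMap.smul_apply, smul_eq_mul, mul_assoc]
    rw [integral_const_mul, integral_const_mul, hf, mul_assoc]

theorem integral_rot_diag {n : ℕ} (f h : C(Sph n, ℝ)) (x y : Sph n) :
    ∫ g, f (rot g x) * h (rot g x) ∂haarProb n = ∫ g, f (rot g y) * h (rot g y) ∂haarProb n :=
  integral_rot_congr (fun u _ => f u * h u) (by rw [dot_self, dot_self] : dot x x = dot y y)

/-- The average of f(gx) h(gy) is c P_k(⟨x, y⟩) by expanding f and c P_l(⟨x, y⟩) by expanding h,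
with the same diagonal value c. If c ≠ 0, then P_k = P_l, against their degrees. -/
theorem integral_zonalSpan_eq_zero {n : ℕ} (hn : 2 ≤ n) {k l : ℕ} (hkl : k ≠ l)
    {f h : C(Sph n, ℝ)} (hf : f ∈ zonalSpan n k) (hh : h ∈ zonalSpan n l) (y : Sph n) :
    ∫ g, f (rot g y) * h (rot g y) ∂haarProb n = 0 := by
  by_contra hne
  have hPQ : gegenbauerP n k = gegenbauerP n l := by
    refine eq_of_eval_dot_eq hn y fun x => ?_
    apply mul_left_cancel₀ hne
    rw [← integral_zonalSpan_rot hn hf h x y, integral_rot_diag f h y x, dot_comm x y]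
    simp only [mul_comm (f _)]
    exact integral_zonalSpan_rot hn hh f y x
  apply hkl
  rw [← gegenbauerP_natDegree hn k, hPQ, gegenbauerP_natDegree hn l]

/-- The autocorrelation of a sum of spherical harmonics of different degrees. -/
theorem integral_sum_zonalSpan {n : ℕ} (hn : 2 ≤ n) (K : Finset ℕ) (F : ℕ → C(Sph n, ℝ))
    (hF : ∀ k ∈ K, F k ∈ zonalSpan n k) (x y z : Sph n) :
    ∫ g, (∑ k ∈ K, F k) (rot g x) * (∑ k ∈ K, F k) (rot g y) ∂haarProb n =
      ∑ k ∈ K, (∫ g, F k (rot g z) ^ 2 ∂haarProb n) * (gegenbauerP n k).eval (dot x y) := by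
  have e : ∀ g : OrthGroup n, (∑ k ∈ K, F k) (rot g x) * (∑ k ∈ K, F k) (rot g y) =
      ∑ k ∈ K, ∑ l ∈ K, F k (rot g x) * F l (rot g y) := by
    intro g
    rw [ContinuousMap.sum_apply, ContinuousMap.sum_apply, Finset.sum_mul_sum]
  simp only [e]
  rw [integral_finsetSum _ fun k _ => integrable_finsetSum _ fun l _ => integrable_rot_mul _ _ _ _]
  refine Finset.sum_congr rfl fun k hk => ?_
  rw [integral_finsetSum _ fun l _ => integrable_rot_mul _ _ _ _, Finset.sum_eq_single k]
  · rw [integral_zonalSpan_rot hn (hF k hk), integral_rot_diag _ _ y z]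
    simp only [sq]
  · intro l hl hlk
    rw [integral_zonalSpan_rot hn (hF k hk),
      integral_zonalSpan_eq_zero hn hlk.symm (hF k hk) (hF l hl), zero_mul]
  · exact fun h => absurd hk h

theorem zonalSpan_apply_neg {n : ℕ} (hn : 2 ≤ n) {k : ℕ} {f : C(Sph n, ℝ)}
    (hf : f ∈ zonalSpan n k) (x : Sph n) : f (-x) = (-1) ^ k * f x := by
  induction hf using Submodule.span_induction with
  | mem f hf =>
    obtain ⟨a, rfl⟩ := hf
    change (gegenbauerP n k).eval (dot (-x) a) = _ * (gegenbauerP n k).eval (dot x a)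
    rw [← gegenbauerP_eval_neg hn]
    congr 1
    exact inner_neg_left _ _
  | zero => simp
  | add f f' _ _ hf hf' =>
    simp only [ContinuousMap.add_apply, hf, hf']; ring
  | smul c f _ hf =>
    simp only [ContinuousMap.smul_apply, smul_eq_mul, hf]; ring

theorem ridge_mem_iSup {n : ℕ} (hn : 2 ≤ n) (p : ℝ[X]) (a : Sph n) :
    ridge p a ∈ ⨆ k, zonalSpan n k := by
  have hp := mem_span_gegenbauerP hn p
  induction hp using Submodule.span_induction with
  | mem p hp =>
    obtain ⟨k, rfl⟩ := hp
    exact Submodule.mem_iSup_of_mem k (Submodule.subset_span ⟨a, rfl⟩)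
  | zero =>
    have : ridge (0 : ℝ[X]) a = 0 := by ext x; simp [ridge]
    rw [this]; exact Submodule.zero_mem _
  | add p q _ _ hp hq =>
    have : ridge (p + q) a = ridge p a + ridge q a := by ext x; simp [ridge]
    rw [this]; exact Submodule.add_mem _ hp hq
  | smul c p _ hp =>
    have : ridge (c • p) a = c • ridge p a := by ext x; simp [ridge]
    rw [this]; exact Submodule.smul_mem _ _ hp

/-- The restriction to the sphere of the linear form `⟨·, z⟩`. -/
def linearForm {n : ℕ} (z : EuclideanSpace ℝ (Fin n)) : C(Sph n, ℝ) :=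
  ⟨fun x => inner ℝ (x : EuclideanSpace ℝ (Fin n)) z, continuous_subtype_val.inner continuous_const⟩

theorem linearForm_pow_mem_iSup {n : ℕ} (hn : 2 ≤ n) (z : EuclideanSpace ℝ (Fin n)) (m : ℕ) :
    linearForm z ^ m ∈ ⨆ k, zonalSpan n k := by
  have key : ∃ (r : ℝ) (a : Sph n), z = r • (a : EuclideanSpace ℝ (Fin n)) := by
    by_cases hz : z = 0
    · exact ⟨0, ⟨EuclideanSpace.single ⟨0, by omega⟩ 1, by simp⟩, by simp [hz]⟩
    · have hz' : ‖z‖ ≠ 0 := norm_ne_zero_iff.mpr hz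
      refine ⟨‖z‖, ⟨‖z‖⁻¹ • z, ?_⟩, ?_⟩
      · rw [mem_sphere_zero_iff_norm, norm_smul, norm_inv, norm_norm, inv_mul_cancel₀ hz']
      · rw [smul_smul, mul_inv_cancel₀ hz', one_smul]
  obtain ⟨r, a, rfl⟩ := key
  have : linearForm (r • (a : EuclideanSpace ℝ (Fin n))) ^ m = ridge ((C r * X) ^ m) a := by
    ext x
    simp [linearForm, ridge, inner_smul_right]
  rw [this]
  exact ridge_mem_iSup hn _ a

/-- Exponentials of linear forms are limits of combinations of powers of linear forms. Unlike those
powers they are closed under multiplication, so Stone–Weierstrass applies to their span without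
decomposing products of harmonics. -/
theorem exp_linearForm_mem_closure {n : ℕ} (hn : 2 ≤ n) (z : EuclideanSpace ℝ (Fin n)) :
    NormedSpace.exp (linearForm z) ∈ (⨆ k, zonalSpan n k).topologicalClosure := by
  have h := NormedSpace.exp_series_hasSum_exp' (𝕂 := ℝ) (linearForm z)
  refine (Submodule.isClosed_topologicalClosure _).mem_of_tendsto h
    (Filter.Eventually.of_forall fun s => ?_)
  exact Submodule.sum_mem _ fun m _ => Submodule.smul_mem _ _
    (Submodule.le_topologicalClosure _ (linearForm_pow_mem_iSup hn z m))

theorem exp_linearForm_apply {n : ℕ} (z : EuclideanSpace ℝ (Fin n)) (x : Sph n) :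
    NormedSpace.exp (linearForm z) x = Real.exp (inner ℝ (x : EuclideanSpace ℝ (Fin n)) z) := by
  have h := NormedSpace.map_exp (ContinuousMap.evalAlgHom ℝ ℝ x)
    (continuous_eval_const x) (linearForm z)
  rw [← Real.exp_eq_exp_ℝ] at h
  exact h

/-- The exponentials of linear forms, as a multiplicative family. -/
def expLinearForm (n : ℕ) : Multiplicative (EuclideanSpace ℝ (Fin n)) →* C(Sph n, ℝ) where
  toFun z := NormedSpace.exp (linearForm z.toAdd)
  map_one' := by ext x; simp [exp_linearForm_apply]
  map_mul' z z' := by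
    ext x
    simp [exp_linearForm_apply, inner_add_right, Real.exp_add]

/-- Sums of spherical harmonics are dense in the continuous functions on the sphere. -/
theorem iSup_zonalSpan_topologicalClosure {n : ℕ} (hn : 2 ≤ n) :
    (⨆ k, zonalSpan n k).topologicalClosure = ⊤ := by
  set A : Subalgebra ℝ C(Sph n, ℝ) := Algebra.adjoin ℝ (MonoidHom.mrange (expLinearForm n))
    with hA
  have hle : Subalgebra.toSubmodule A ≤ (⨆ k, zonalSpan n k).topologicalClosure := by
    rw [hA, Algebra.adjoin_eq_span, Submonoid.closure_eq, Submodule.span_le]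
    rintro _ ⟨z, rfl⟩
    exact exp_linearForm_mem_closure hn z.toAdd
  have hsep : A.SeparatesPoints := by
    intro x y hxy
    have hne : (x : EuclideanSpace ℝ (Fin n)) ≠ y := fun h => hxy (Subtype.ext h)
    obtain ⟨z, hz⟩ : ∃ z : EuclideanSpace ℝ (Fin n),
        inner ℝ (x : EuclideanSpace ℝ (Fin n)) z ≠ inner ℝ (y : EuclideanSpace ℝ (Fin n)) z := by
      by_contra! h
      exact hne (ext_inner_right ℝ h)
    refine ⟨_, ⟨expLinearForm n (Multiplicative.ofAdd z),
      Algebra.subset_adjoin ⟨_, rfl⟩, rfl⟩, ?_⟩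
    change NormedSpace.exp (linearForm z) x ≠ NormedSpace.exp (linearForm z) y
    rw [exp_linearForm_apply, exp_linearForm_apply]
    exact fun h => hz (Real.exp_injective h)
  have htop := ContinuousMap.subalgebra_topologicalClosure_eq_top_of_separatesPoints A hsep
  rw [eq_top_iff]
  intro f _
  have hf : f ∈ closure (A : Set C(Sph n, ℝ)) := by
    rw [← Subalgebra.topologicalClosure_coe, htop]; trivial
  exact closure_minimal hle (Submodule.isClosed_topologicalClosure _) hf

theorem exists_sum_zonalSpan_near {n : ℕ} (hn : 2 ≤ n) (u : C(Sph n, ℝ)) {ε : ℝ} (hε : 0 < ε) :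
    ∃ (K : Finset ℕ) (F : ℕ → C(Sph n, ℝ)), (∀ k, F k ∈ zonalSpan n k) ∧
      ∀ x, |u x - (∑ k ∈ K, F k) x| < ε := by
  have hu : u ∈ closure ((⨆ k, zonalSpan n k : Submodule ℝ C(Sph n, ℝ)) : Set C(Sph n, ℝ)) := by
    rw [← Submodule.topologicalClosure_coe, iSup_zonalSpan_topologicalClosure hn]; trivial
  obtain ⟨f, hf, hd⟩ := Metric.mem_closure_iff.mp hu ε hε
  obtain ⟨F, hF, hsum⟩ := (Submodule.mem_iSup_iff_exists_finsupp _ f).mp hf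
  refine ⟨F.support, F, hF, fun x => ?_⟩
  have : ∑ k ∈ F.support, F k = f := hsum
  rw [this, ← Real.dist_eq]
  exact (ContinuousMap.dist_apply_le_dist x).trans_lt hd

/-- A continuous even function is uniformly close to sums of spherical harmonics of even degree. -/
theorem exists_sum_even_zonalSpan_near {n : ℕ} (hn : 2 ≤ n) (u : C(Sph n, ℝ))
    (hu : ∀ x, u (-x) = u x) {ε : ℝ} (hε : 0 < ε) :
    ∃ (K : Finset ℕ) (F : ℕ → C(Sph n, ℝ)), (∀ k ∈ K, Even k) ∧ (∀ k, F k ∈ zonalSpan n k) ∧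
      ∀ x, |u x - (∑ k ∈ K, F k) x| < ε := by
  obtain ⟨K, F, hF, h⟩ := exists_sum_zonalSpan_near hn u hε
  refine ⟨K.filter Even, F, fun k hk => (Finset.mem_filter.mp hk).2, hF, fun x => ?_⟩
  -- By parity, discarding the odd degrees amounts to averaging over x and -x.
  have e : (∑ k ∈ K.filter Even, F k) x =
      ((∑ k ∈ K, F k) x + (∑ k ∈ K, F k) (-x)) / 2 := by
    simp only [ContinuousMap.sum_apply]
    rw [← Finset.sum_add_distrib, Finset.sum_div, Finset.sum_filter]
    refine Finset.sum_congr rfl fun k _ => ?_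
    rw [zonalSpan_apply_neg hn (hF k)]
    split_ifs with hk
    · rw [hk.neg_one_pow]; ring
    · rw [(Nat.not_even_iff_odd.mp hk).neg_one_pow]; ring
  have h1 := h x
  have h2 := h (-x)
  rw [hu] at h2
  rw [e]
  rw [abs_lt] at *
  constructor <;> linarith

/-! ### Approximating autocorrelations of symmetric sets -/

/-- The probability that a random rotation moves both `x` and `y` into `A`, as an integral. -/
def autocorrelation {n : ℕ} (A : Set (Sph n)) (x y : Sph n) : ℝ :=
  ∫ g, A.indicator 1 (rot g x) * A.indicator 1 (rot g y) ∂haarProb n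

theorem indicator_one_eq_zero_or_one {α : Type*} (A : Set α) (x : α) :
    A.indicator (1 : α → ℝ) x = 0 ∨ A.indicator (1 : α → ℝ) x = 1 :=
  (Set.indicator_eq_zero_or_self A 1 x)

theorem measurable_indicator_rot {n : ℕ} {A : Set (Sph n)} (hA : MeasurableSet A) (x : Sph n) :
    Measurable fun g : OrthGroup n => A.indicator (1 : Sph n → ℝ) (rot g x) :=
  (measurable_one.indicator hA).comp (continuous_rot_left x).measurable

theorem integrable_indicator_sub_sq {n : ℕ} {A : Set (Sph n)} (hA : MeasurableSet A)
    (u : C(Sph n, ℝ)) (x : Sph n) :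
    Integrable (fun g : OrthGroup n => (A.indicator 1 (rot g x) - u (rot g x)) ^ 2)
      (haarProb n) := by
  obtain ⟨K, hK⟩ := (isCompact_range u.continuous).isBounded.exists_norm_le
  have hm := (measurable_indicator_rot hA x).sub
    (u.continuous.comp (continuous_rot_left x)).measurable
  refine Integrable.of_bound (hm.pow_const 2).aestronglyMeasurable ((1 + K) ^ 2)
    (Filter.Eventually.of_forall fun g => ?_)
  have h1 : ‖u (rot g x)‖ ≤ K := hK _ ⟨_, rfl⟩
  rw [norm_pow]
  refine pow_le_pow_left₀ (norm_nonneg _) ((norm_sub_le _ _).trans (add_le_add ?_ h1)) 2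
  rcases indicator_one_eq_zero_or_one A (rot g x) with h | h <;> rw [h] <;> simp

/-- Continuous functions are dense in L² of the image of Haar measure on the sphere. The error does
not depend on x, by transitivity, so one u serves all x. -/
theorem exists_continuous_near_indicator {n : ℕ} {A : Set (Sph n)} (hA : MeasurableSet A)
    {ε : ℝ} (hε : 0 < ε) :
    ∃ u : C(Sph n, ℝ), ∀ x,
      ∫ g, (A.indicator 1 (rot g x) - u (rot g x)) ^ 2 ∂haarProb n ≤ ε := by
  rcases isEmpty_or_nonempty (Sph n) with hS | ⟨⟨z⟩⟩
  · exact ⟨0, fun x => (hS.false x).elim⟩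
  set σ := (haarProb n).map (fun g => rot g z) with hσ
  have : IsProbabilityMeasure σ :=
    Measure.isProbabilityMeasure_map (continuous_rot_left z).measurable.aemeasurable
  have hmem : MemLp (A.indicator (1 : Sph n → ℝ)) (ENNReal.ofReal 2) σ :=
    (memLp_indicator_const _ hA (1 : ℝ) (Or.inr (measure_ne_top _ _)))
  obtain ⟨u, hu, -⟩ := hmem.exists_boundedContinuous_integral_rpow_sub_le two_pos hε
  refine ⟨u.toContinuousMap, fun x => ?_⟩
  have hxz := integral_rot_congr (fun v _ => (A.indicator 1 v - u v) ^ 2)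
    (by rw [dot_self, dot_self] : dot x x = dot z z)
  refine le_trans (le_of_eq ?_) hu
  rw [integral_map (continuous_rot_left z).measurable.aemeasurable]
  · refine Eq.trans hxz (integral_congr_ae (Filter.Eventually.of_forall fun g => ?_))
    simp only [Real.rpow_two, Real.norm_eq_abs, sq_abs]
  · refine Measurable.aestronglyMeasurable ?_
    exact (((measurable_one.indicator hA).sub u.continuous.measurable).norm).pow_const 2

theorem exists_even_continuous_near_indicator {n : ℕ} {A : Set (Sph n)} (hA : MeasurableSet A)
    (hneg : ∀ x, -x ∈ A ↔ x ∈ A) {ε : ℝ} (hε : 0 < ε) :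
    ∃ u : C(Sph n, ℝ), (∀ x, u (-x) = u x) ∧ ∀ x,
      ∫ g, (A.indicator 1 (rot g x) - u (rot g x)) ^ 2 ∂haarProb n ≤ ε := by
  obtain ⟨u, hu⟩ := exists_continuous_near_indicator hA hε
  refine ⟨⟨fun x => (u x + u (-x)) / 2, by fun_prop⟩, fun x => ?_, fun x => ?_⟩
  · simp [add_comm]
  -- Convexity of the square, together with the symmetry of `A`, shows that symmetrizing u does not
  -- increase the error bound.
  have hle : ∫ g, (A.indicator 1 (rot g x) - (u (rot g x) + u (-rot g x)) / 2) ^ 2 ∂haarProb n ≤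
      ∫ g, ((A.indicator 1 (rot g x) - u (rot g x)) ^ 2 / 2
        + (A.indicator 1 (rot g (-x)) - u (rot g (-x))) ^ 2 / 2) ∂haarProb n := by
    refine integral_mono (integrable_indicator_sub_sq hA
      ⟨fun x => (u x + u (-x)) / 2, by fun_prop⟩ x)
      (((integrable_indicator_sub_sq hA u x).div_const 2).add
        ((integrable_indicator_sub_sq hA u (-x)).div_const 2)) fun g => ?_
    have hi : A.indicator (1 : Sph n → ℝ) (rot g (-x)) = A.indicator 1 (rot g x) := by
      rw [rot_neg]
      simp only [Set.indicator, hneg]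
      rfl
    simp only [hi]
    rw [rot_neg]
    nlinarith [sq_nonneg (u (rot g x) - u (-rot g x))]
  refine hle.trans ?_
  rw [integral_add ((integrable_indicator_sub_sq hA u x).div_const 2)
    ((integrable_indicator_sub_sq hA u (-x)).div_const 2), integral_div, integral_div]
  linarith [hu x, hu (-x)]

theorem exists_zonal_near_indicator {n : ℕ} (hn : 2 ≤ n) {A : Set (Sph n)}
    (hA : MeasurableSet A) (hneg : ∀ x, -x ∈ A ↔ x ∈ A) {ε : ℝ} (hε : 0 < ε) :
    ∃ (K : Finset ℕ) (F : ℕ → C(Sph n, ℝ)), (∀ k ∈ K, Even k) ∧ (∀ k, F k ∈ zonalSpan n k) ∧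
      ∀ x, ∫ g, (A.indicator 1 (rot g x) - (∑ k ∈ K, F k) (rot g x)) ^ 2 ∂haarProb n ≤ ε := by
  -- From (a + b)² ≤ 2a² + 2b², the two errors contribute 2 · ε/4 each.
  obtain ⟨u, hu, h⟩ := exists_even_continuous_near_indicator hA hneg (ε := ε / 4) (by positivity)
  obtain ⟨K, F, hK, hF, hd⟩ := exists_sum_even_zonalSpan_near hn u hu (ε := √(ε / 4))
    (by positivity)
  refine ⟨K, F, hK, hF, fun x => ?_⟩
  set f := ∑ k ∈ K, F k
  have hle : ∫ g, (A.indicator 1 (rot g x) - f (rot g x)) ^ 2 ∂haarProb n ≤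
      ∫ g, (2 * (A.indicator 1 (rot g x) - u (rot g x)) ^ 2 + ε / 2) ∂haarProb n := by
    refine integral_mono (integrable_indicator_sub_sq hA f x)
      (((integrable_indicator_sub_sq hA u x).const_mul 2).add (integrable_const _)) fun g => ?_
    have h1 : (u (rot g x) - f (rot g x)) ^ 2 ≤ ε / 4 := by
      rw [← Real.sq_sqrt (show 0 ≤ ε / 4 by positivity), ← sq_abs]
      exact pow_le_pow_left₀ (abs_nonneg _) (hd _).le 2
    simp only
    nlinarith [sq_nonneg ((A.indicator 1 (rot g x) - u (rot g x)) - (u (rot g x) - f (rot g x)))]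
  refine hle.trans ?_
  rw [integral_add ((integrable_indicator_sub_sq hA u x).const_mul 2) (integrable_const _),
    integral_const_mul]
  simp only [integral_const, probReal_univ, one_smul]
  linarith [h x]

theorem integrable_autocorrelation {n : ℕ} {A : Set (Sph n)} (hA : MeasurableSet A)
    (x y : Sph n) :
    Integrable (fun g : OrthGroup n => A.indicator (1 : Sph n → ℝ) (rot g x)
      * A.indicator (1 : Sph n → ℝ) (rot g y)) (haarProb n) := by
  refine Integrable.of_bound ((measurable_indicator_rot hA x).mul
    (measurable_indicator_rot hA y)).aestronglyMeasurable 1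
    (Filter.Eventually.of_forall fun g => ?_)
  rcases indicator_one_eq_zero_or_one A (rot g x) with h | h <;>
  rcases indicator_one_eq_zero_or_one A (rot g y) with h' | h' <;> rw [h, h'] <;> simp

theorem exists_zonal_near_autocorrelation {n : ℕ} (hn : 2 ≤ n) {A : Set (Sph n)}
    (hA : MeasurableSet A) (hneg : ∀ x, -x ∈ A ↔ x ∈ A) {δ : ℝ} (hδ : 0 < δ) :
    ∃ (K : Finset ℕ) (F : ℕ → C(Sph n, ℝ)), (∀ k ∈ K, Even k) ∧ (∀ k, F k ∈ zonalSpan n k) ∧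
      ∀ x y, |autocorrelation A x y -
        ∫ g, (∑ k ∈ K, F k) (rot g x) * (∑ k ∈ K, F k) (rot g y) ∂haarProb n| ≤ δ := by
  -- With L² errors η² the final bound is η + 2(η/2 + η²/2) = 2η + η² ≤ 3η ≤ δ.
  set η : ℝ := min 1 (δ / 3) with hη
  have hη0 : 0 < η := by positivity
  have hη1 : η ≤ 1 := min_le_left _ _
  have hηδ : 3 * η ≤ δ := by
    have : η ≤ δ / 3 := min_le_right _ _
    linarith
  obtain ⟨K, F, hK, hF, h⟩ := exists_zonal_near_indicator hn hA hneg (ε := η ^ 2) (by positivity)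
  refine ⟨K, F, hK, hF, fun x y => ?_⟩
  set f := ∑ k ∈ K, F k
  have hid := fun z => integrable_indicator_sub_sq hA f z
  rw [autocorrelation, ← integral_sub (integrable_autocorrelation hA x y)
    (integrable_rot_mul f f x y)]
  refine (abs_integral_le_integral_abs).trans ?_
  have hle : ∫ g, |A.indicator 1 (rot g x) * A.indicator 1 (rot g y)
        - f (rot g x) * f (rot g y)| ∂haarProb n ≤
      ∫ g, (η + ((1 / (2 * η) + 1 / 2) * (A.indicator 1 (rot g x) - f (rot g x)) ^ 2 +
        (1 / (2 * η) + 1 / 2) * (A.indicator 1 (rot g y) - f (rot g y)) ^ 2)) ∂haarProb n := by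
    refine integral_mono ((integrable_autocorrelation hA x y).sub
      (integrable_rot_mul f f x y)).abs ((integrable_const _).add
        (((hid x).const_mul _).add ((hid y).const_mul _))) fun g => ?_
    -- This weighted AM-GM inequality takes the place of Cauchy–Schwarz for bounding the mean of |d|
    -- by that of d².
    have ha : ∀ d : ℝ, |d| ≤ η / 2 + 1 / (2 * η) * d ^ 2 := by
      intro d
      have : 0 ≤ (|d| - η) ^ 2 / (2 * η) := by positivity
      have e : (|d| - η) ^ 2 / (2 * η) = η / 2 + 1 / (2 * η) * d ^ 2 - |d| := by
        rw [← sq_abs d]; field_simp; ring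
      linarith
    have hb : ∀ z, |A.indicator (1 : Sph n → ℝ) z| ≤ 1 := by
      intro z
      rcases indicator_one_eq_zero_or_one A z with h | h <;> rw [h] <;> simp
    set a := A.indicator (1 : Sph n → ℝ) (rot g x)
    set b := A.indicator (1 : Sph n → ℝ) (rot g y)
    set d := a - f (rot g x) with hd
    set d' := b - f (rot g y) with hd'
    have e : a * b - f (rot g x) * f (rot g y) = a * d' + d * b - d * d' := by
      rw [hd, hd']; ring
    have h1 : |a * d'| ≤ |d'| := by
      rw [abs_mul]; exact mul_le_of_le_one_left (abs_nonneg _) (hb _)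
    have h2 : |d * b| ≤ |d| := by
      rw [abs_mul]; exact mul_le_of_le_one_right (abs_nonneg _) (hb _)
    have h3 : |d * d'| ≤ (d ^ 2 + d' ^ 2) / 2 := by
      rw [abs_mul, ← sq_abs d, ← sq_abs d']
      nlinarith [sq_nonneg (|d| - |d'|)]
    have h4 : |a * d' + d * b - d * d'| ≤ |a * d'| + |d * b| + |d * d'| :=
      (abs_sub _ _).trans (add_le_add (abs_add_le _ _) le_rfl)
    simp only
    rw [e]
    linarith [ha d, ha d']
  refine hle.trans ?_
  have hsum : Integrable (fun g : OrthGroup n =>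
      (1 / (2 * η) + 1 / 2) * (A.indicator 1 (rot g x) - f (rot g x)) ^ 2 +
        (1 / (2 * η) + 1 / 2) * (A.indicator 1 (rot g y) - f (rot g y)) ^ 2) (haarProb n) :=
    ((hid x).const_mul _).add ((hid y).const_mul _)
  rw [integral_add (integrable_const _) hsum,
    integral_add ((hid x).const_mul _) ((hid y).const_mul _), integral_const_mul,
    integral_const_mul]
  simp only [integral_const, probReal_univ, one_smul]
  have hc : 0 ≤ 1 / (2 * η) + 1 / 2 := by positivity
  have hx := mul_le_mul_of_nonneg_left (h x) hc
  have hy := mul_le_mul_of_nonneg_left (h y) hc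
  have e : (1 / (2 * η) + 1 / 2) * η ^ 2 = η / 2 + η ^ 2 / 2 := by field_simp
  nlinarith

/-- A linear inequality that holds for all Gegenbauer polynomials of even degree holds for
autocorrelations of symmetric sets. -/
theorem autocorrelation_self_le {n : ℕ} (hn : 2 ≤ n) {A : Set (Sph n)}
    (hA : MeasurableSet A) (hneg : ∀ x, -x ∈ A ↔ x ∈ A) {ι : Type*} (S : Finset ι)
    (c : ι → ℝ) (a b : ι → Sph n) (z : Sph n)
    (h : ∀ k, Even k → 1 ≤ ∑ i ∈ S, c i * (gegenbauerP n k).eval (dot (a i) (b i))) :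
    autocorrelation A z z ≤ ∑ i ∈ S, c i * autocorrelation A (a i) (b i) := by
  -- An error δ in each autocorrelation costs δ on the left and δ Σ|c i| on the right, in total δM =
  -- ε.
  set M : ℝ := 1 + ∑ i ∈ S, |c i| with hM
  have hM0 : 0 < M := by
    have : 0 ≤ ∑ i ∈ S, |c i| := Finset.sum_nonneg fun i _ => abs_nonneg _
    linarith
  refine le_of_forall_pos_le_add fun ε hε => ?_
  obtain ⟨K, F, hK, hF, hd⟩ := exists_zonal_near_autocorrelation hn hA hneg
    (δ := ε / M) (by positivity)
  set δ := ε / M with hδ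
  set Q : Sph n → Sph n → ℝ := fun x y =>
    ∫ g, (∑ k ∈ K, F k) (rot g x) * (∑ k ∈ K, F k) (rot g y) ∂haarProb n with hQ
  have hQe : ∀ x y, Q x y = ∑ k ∈ K,
      (∫ g, F k (rot g z) ^ 2 ∂haarProb n) * (gegenbauerP n k).eval (dot x y) :=
    fun x y => integral_sum_zonalSpan hn K F (fun k _ => hF k) x y z
  -- Q is a combination of the P_k with k ∈ K even and nonnegative weights, so the hypotheses can be
  -- summed over k.
  have hQle : Q z z ≤ ∑ i ∈ S, c i * Q (a i) (b i) := by
    have e : ∑ i ∈ S, c i * Q (a i) (b i) = ∑ k ∈ K, (∫ g, F k (rot g z) ^ 2 ∂haarProb n) *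
        ∑ i ∈ S, c i * (gegenbauerP n k).eval (dot (a i) (b i)) := by
      simp only [hQe, Finset.mul_sum]
      rw [Finset.sum_comm]
      exact Finset.sum_congr rfl fun k _ => Finset.sum_congr rfl fun i _ => by ring
    rw [e, hQe]
    refine Finset.sum_le_sum fun k hk => ?_
    rw [dot_self, gegenbauerP_eval_one hn]
    exact mul_le_mul_of_nonneg_left (h k (hK k hk)) (integral_nonneg fun g => sq_nonneg _)
  have h1 : autocorrelation A z z ≤ Q z z + δ := by
    have := (abs_le.mp (hd z z)).2
    linarith
  have h2 : ∑ i ∈ S, c i * Q (a i) (b i) ≤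
      ∑ i ∈ S, (c i * autocorrelation A (a i) (b i) + |c i| * δ) := by
    refine Finset.sum_le_sum fun i _ => ?_
    have h3 : c i * (Q (a i) (b i) - autocorrelation A (a i) (b i)) ≤ |c i| * δ := by
      refine (le_abs_self _).trans ?_
      rw [abs_mul, abs_sub_comm]
      exact mul_le_mul_of_nonneg_left (hd _ _) (abs_nonneg _)
    linarith
  rw [Finset.sum_add_distrib, ← Finset.sum_mul] at h2
  have h3 : δ + (∑ i ∈ S, |c i|) * δ = ε := by
    rw [hδ]
    field_simp
    rw [hM]
  linarith

theorem autocorrelation_eq_zero {n : ℕ} {A : Set (Sph n)} (hA : AvoidsOrthogonality A)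
    {x y : Sph n} (h : dot x y = 0) : autocorrelation A x y = 0 := by
  unfold autocorrelation
  rw [integral_eq_zero_of_ae]
  refine Filter.Eventually.of_forall fun g => ?_
  by_cases h1 : rot g x ∈ A
  · by_cases h2 : rot g y ∈ A
    · exact absurd ((inner_rot_rot g x y).trans h) (hA _ h1 _ h2)
    · simp [h2]
  · simp [h1]

theorem autocorrelation_self {n : ℕ} (hn : 2 ≤ n) {A : Set (Sph n)} (hA : MeasurableSet A)
    (z : Sph n) :
    autocorrelation A z z = (surfaceMeasure n).real A / (surfaceMeasure n).real Set.univ := by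
  have h1 : autocorrelation A z z = (haarProb n).real {g | rot g z ∈ A} := by
    unfold autocorrelation
    refine Eq.trans (integral_congr_ae (Filter.Eventually.of_forall fun g => ?_))
      (integral_indicator_one (μ := haarProb n) ((continuous_rot_left z).measurable hA))
    by_cases h : rot g z ∈ A <;> simp [h, Set.indicator]
  have h2 := congrArg ENNReal.toReal (haarProb_mul_surfaceMeasure z hA)
  rw [ENNReal.toReal_mul] at h2
  have h3 : (surfaceMeasure n).real Set.univ ≠ 0 := by
    rw [Measure.real, ENNReal.toReal_ne_zero]
    exact ⟨surfaceMeasure_univ_ne_zero hn, measure_ne_top _ _⟩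
  rw [h1, eq_div_iff h3]
  exact h2

/-! ### Averaging the inequalities for independent sets -/

/-- T determines the points x j only up to sign, which the symmetry of `A` absorbs. -/
theorem forall_rot_mem_iff_of_image_eq {n N : ℕ} {x : Fin N → Sph n} {Y Z : Finset (Fin N)}
    {A : Set (Sph n)} (hneg : ∀ x, -x ∈ A ↔ x ∈ A)
    {T : EuclideanSpace ℝ (Fin n) ≃ₗᵢ[ℝ] EuclideanSpace ℝ (Fin n)}
    (hT : (fun i => T '' antipodalPair x i) '' (Y : Set (Fin N)) =
      antipodalPair x '' (Z : Set (Fin N))) (g : OrthGroup n) :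
    (∀ i ∈ Y, rot (g * Unitary.linearIsometryEquiv.symm T) (x i) ∈ A) ↔
      ∀ j ∈ Z, rot g (x j) ∈ A := by
  set t := Unitary.linearIsometryEquiv.symm T with ht
  have hcoe : ∀ y : Sph n, (rot t y : EuclideanSpace ℝ (Fin n)) = T y := fun y => rfl
  have key : ∀ i j, T (x i) ∈ antipodalPair x j → (rot g (rot t (x i)) ∈ A ↔ rot g (x j) ∈ A) := by
    intro i j h
    rcases h with h | h
    · have : rot t (x i) = x j := Subtype.ext h
      rw [this]
    · have : rot t (x i) = -x j := Subtype.ext h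
      rw [this, rot_neg, hneg]
  have hmem : ∀ i, T (x i) ∈ T '' antipodalPair x i := fun i => ⟨_, Or.inl rfl, rfl⟩
  constructor
  · intro h j hj
    obtain ⟨i, hi, hij⟩ : antipodalPair x j ∈
        (fun i => T '' antipodalPair x i) '' (Y : Set (Fin N)) := by
      rw [hT]; exact ⟨j, hj, rfl⟩
    simp only at hij
    exact (key i j (hij ▸ hmem i)).mp (h i hi)
  · intro h i hi
    obtain ⟨j, hj, hij⟩ : T '' antipodalPair x i ∈ antipodalPair x '' (Z : Set (Fin N)) := by
      rw [← hT]; exact ⟨i, hi, rfl⟩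
    exact (key i j (hij ▸ hmem i)).mpr (h j hj)

/-- The probability that a random rotation moves all points `x i`, `i ∈ Y`, into `A`. -/
def hitProb {n N : ℕ} (x : Fin N → Sph n) (A : Set (Sph n)) (Y : Finset (Fin N)) : ℝ :=
  ∫ g, (if ∀ i ∈ Y, rot g (x i) ∈ A then (1 : ℝ) else 0) ∂haarProb n

/-- The substitution g ↦ gT, allowed by right invariance, turns one event into the other. -/
theorem hitProb_eq_of_geomCongruent {n N : ℕ} {x : Fin N → Sph n} {Y Z : Finset (Fin N)}
    {A : Set (Sph n)} (hneg : ∀ x, -x ∈ A ↔ x ∈ A) (h : GeomCongruent x Y Z) :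
    hitProb x A Y = hitProb x A Z := by
  obtain ⟨T, hT⟩ := h
  unfold hitProb
  rw [← integral_rot_invariant _ (Unitary.linearIsometryEquiv.symm T)]
  simp only [forall_rot_mem_iff_of_image_eq hneg hT]

theorem integrable_hit {n N : ℕ} (x : Fin N → Sph n) {A : Set (Sph n)} (hA : MeasurableSet A)
    (Y : Finset (Fin N)) :
    Integrable (fun g => if ∀ i ∈ Y, rot g (x i) ∈ A then (1 : ℝ) else 0) (haarProb n) := by
  have hm : MeasurableSet {g : OrthGroup n | ∀ i ∈ Y, rot g (x i) ∈ A} := by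
    have : {g : OrthGroup n | ∀ i ∈ Y, rot g (x i) ∈ A} =
        ⋂ i ∈ Y, (fun g => rot g (x i)) ⁻¹' A := by ext g; simp
    rw [this]
    exact Finset.measurableSet_biInter _ fun i _ => (continuous_rot_left (x i)).measurable hA
  refine Integrable.of_bound
    (Measurable.ite hm measurable_const measurable_const).aestronglyMeasurable 1
    (Filter.Eventually.of_forall fun g => ?_)
  split_ifs <;> simp

theorem integral_const_sub_add_sub {G : Type*} [MeasurableSpace G] {μ : Measure G}
    [IsProbabilityMeasure μ] (q : ℝ) {f₁ f₂ f₃ : G → ℝ} (h₁ : Integrable f₁ μ)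
    (h₂ : Integrable f₂ μ) (h₃ : Integrable f₃ μ) :
    ∫ g, (q - f₁ g + f₂ g - f₃ g) ∂μ = q - ∫ g, f₁ g ∂μ + ∫ g, f₂ g ∂μ - ∫ g, f₃ g ∂μ := by
  have h0 : Integrable (fun _ : G => q) μ := integrable_const q
  have h01 : Integrable (fun g => q - f₁ g) μ := h0.sub h₁
  have h012 : Integrable (fun g => q - f₁ g + f₂ g) μ := h01.add h₂
  rw [integral_sub h012 h₃, integral_add h01 h₂, integral_sub h0 h₁]
  simp

/-- The average over all rotations of the inequalities for the independent sets. -/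
theorem sum_mul_autocorrelation_le {n N : ℕ} (x : Fin N → Sph n) {A : Set (Sph n)}
    (hA : MeasurableSet A) (hneg : ∀ x, -x ∈ A ↔ x ∈ A) (hav : AvoidsOrthogonality A)
    (q₁ : ℝ) (s : Finset (Fin N) → Finset (Fin N) → ℝ) (w : Fin N → Fin N → ℝ)
    (hI : ∀ I : Finset (Fin N), (orthogonalityGraph x).IsIndepSet (I : Set (Fin N)) →
      0 ≤ q₁
        - ∑ p : Fin N × Fin N with p.1 ≤ p.2 ∧ p.1 ∈ I ∧ p.2 ∈ I, w p.1 p.2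
        + ∑ p : Finset (Fin N) × Finset (Fin N)
            with GeomCongruent x p.1 p.2 ∧ p.1 ⊆ I, s p.1 p.2
        - ∑ p : Finset (Fin N) × Finset (Fin N)
            with GeomCongruent x p.1 p.2 ∧ p.2 ⊆ I, s p.1 p.2) :
    ∑ p : Fin N × Fin N with p.1 ≤ p.2, w p.1 p.2 * autocorrelation A (x p.1) (x p.2) ≤ q₁ := by
  set C : Finset (Finset (Fin N) × Finset (Fin N)) :=
    Finset.univ.filter fun p => GeomCongruent x p.1 p.2
  set D : Finset (Fin N × Fin N) := Finset.univ.filter fun p => p.1 ≤ p.2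
  have hpt : ∀ g : OrthGroup n, 0 ≤ q₁
      - ∑ p ∈ D, w p.1 p.2 * (A.indicator 1 (rot g (x p.1)) * A.indicator 1 (rot g (x p.2)))
      + ∑ p ∈ C, s p.1 p.2 * (if ∀ i ∈ p.1, rot g (x i) ∈ A then (1 : ℝ) else 0)
      - ∑ p ∈ C, s p.1 p.2 * (if ∀ i ∈ p.2, rot g (x i) ∈ A then (1 : ℝ) else 0) := by
    intro g
    -- For a fixed rotation, the vertices that land in `A` are independent because rotations
    -- preserve orthogonality.
    set I : Finset (Fin N) := Finset.univ.filter fun i => rot g (x i) ∈ A with hIdef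
    have hmem : ∀ i, i ∈ I ↔ rot g (x i) ∈ A := fun i => by simp [hIdef]
    have hind : (orthogonalityGraph x).IsIndepSet (I : Set (Fin N)) := by
      intro i hi j hj _ hadj
      exact hav _ ((hmem i).mp hi) _ ((hmem j).mp hj) ((inner_rot_rot g _ _).trans hadj)
    have hi := hI I hind
    have e1 : ∑ p : Fin N × Fin N with p.1 ≤ p.2 ∧ p.1 ∈ I ∧ p.2 ∈ I, w p.1 p.2 = ∑ p ∈ D,
        w p.1 p.2 * (A.indicator 1 (rot g (x p.1)) * A.indicator 1 (rot g (x p.2))) := by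
      rw [← Finset.filter_filter, Finset.sum_filter]
      refine Finset.sum_congr rfl fun p _ => ?_
      simp only [hmem]
      by_cases h1 : rot g (x p.1) ∈ A <;> by_cases h2 : rot g (x p.2) ∈ A <;> simp [h1, h2]
    have e2 : ∑ p : Finset (Fin N) × Finset (Fin N) with GeomCongruent x p.1 p.2 ∧ p.1 ⊆ I,
        s p.1 p.2 = ∑ p ∈ C,
          s p.1 p.2 * (if ∀ i ∈ p.1, rot g (x i) ∈ A then (1 : ℝ) else 0) := by
      rw [← Finset.filter_filter, Finset.sum_filter]
      refine Finset.sum_congr rfl fun p _ => ?_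
      simp only [Finset.subset_iff, hmem, mul_ite, mul_one, mul_zero]
    have e3 : ∑ p : Finset (Fin N) × Finset (Fin N) with GeomCongruent x p.1 p.2 ∧ p.2 ⊆ I,
        s p.1 p.2 = ∑ p ∈ C,
          s p.1 p.2 * (if ∀ i ∈ p.2, rot g (x i) ∈ A then (1 : ℝ) else 0) := by
      rw [← Finset.filter_filter, Finset.sum_filter]
      refine Finset.sum_congr rfl fun p _ => ?_
      simp only [Finset.subset_iff, hmem, mul_ite, mul_one, mul_zero]
    rwa [e1, e2, e3] at hi
  have i1 : Integrable (fun g : OrthGroup n => ∑ p ∈ D, w p.1 p.2 *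
      (A.indicator (1 : Sph n → ℝ) (rot g (x p.1)) * A.indicator (1 : Sph n → ℝ) (rot g (x p.2))))
      (haarProb n) :=
    integrable_finsetSum _ fun p _ => (integrable_autocorrelation hA _ _).const_mul _
  have i2 : Integrable (fun g : OrthGroup n => ∑ p ∈ C, s p.1 p.2 *
      (if ∀ i ∈ p.1, rot g (x i) ∈ A then (1 : ℝ) else 0)) (haarProb n) :=
    integrable_finsetSum _ fun p _ => (integrable_hit x hA _).const_mul _
  have i3 : Integrable (fun g : OrthGroup n => ∑ p ∈ C, s p.1 p.2 *
      (if ∀ i ∈ p.2, rot g (x i) ∈ A then (1 : ℝ) else 0)) (haarProb n) :=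
    integrable_finsetSum _ fun p _ => (integrable_hit x hA _).const_mul _
  have h := integral_nonneg (μ := haarProb n) (f := fun g => q₁
      - ∑ p ∈ D, w p.1 p.2 * (A.indicator 1 (rot g (x p.1)) * A.indicator 1 (rot g (x p.2)))
      + ∑ p ∈ C, s p.1 p.2 * (if ∀ i ∈ p.1, rot g (x i) ∈ A then (1 : ℝ) else 0)
      - ∑ p ∈ C, s p.1 p.2 * (if ∀ i ∈ p.2, rot g (x i) ∈ A then (1 : ℝ) else 0)) hpt
  rw [integral_const_sub_add_sub q₁ i1 i2 i3,
    integral_finsetSum _ fun p _ => (integrable_autocorrelation hA _ _).const_mul _,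
    integral_finsetSum _ fun p _ => (integrable_hit x hA _).const_mul _,
    integral_finsetSum _ fun p _ => (integrable_hit x hA _).const_mul _] at h
  simp only [integral_const_mul] at h
  -- Both s-sums have the same mean, so they cancel in the averaged inequality.
  have hs : ∑ p ∈ C, s p.1 p.2 * hitProb x A p.1 = ∑ p ∈ C, s p.1 p.2 * hitProb x A p.2 :=
    Finset.sum_congr rfl fun p hp => by
      rw [hitProb_eq_of_geomCongruent hneg (Finset.mem_filter.mp hp).2]
  unfold hitProb at hs
  unfold autocorrelation
  linarith

/-! ### Reduction to symmetric sets and conclusion -/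

/-- Avoiding orthogonality passes to subsets, so the measurable approximation is taken from inside;
adjoining antipodes only changes signs of inner products. -/
theorem exists_symmetric_measurable {n : ℕ} {A : Set (Sph n)}
    (hA : NullMeasurableSet A (surfaceMeasure n)) (hav : AvoidsOrthogonality A) :
    ∃ B : Set (Sph n), MeasurableSet B ∧ (∀ x, -x ∈ B ↔ x ∈ B) ∧ AvoidsOrthogonality B ∧
      (surfaceMeasure n).real A ≤ (surfaceMeasure n).real B := by
  obtain ⟨A', hsub, hm, hae⟩ := hA.exists_measurable_subset_ae_eq
  refine ⟨A' ∪ (fun x => -x) ⁻¹' A', hm.union (continuous_neg.measurable hm), fun x => ?_, ?_, ?_⟩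
  · simp [or_comm]
  · intro a ha b hb
    rcases ha with ha | ha <;> rcases hb with hb | hb
    · exact hav a (hsub ha) b (hsub hb)
    · have := hav a (hsub ha) (-b) (hsub hb)
      simpa using this
    · have := hav (-a) (hsub ha) b (hsub hb)
      simpa using this
    · have := hav (-a) (hsub ha) (-b) (hsub hb)
      simpa using this
  · rw [← measureReal_congr hae]
    exact measureReal_mono Set.subset_union_left

end Witsenhausen

end

theorem theorem2 (n : ℕ) (hn : 2 ≤ n) (N : ℕ) (x : Fin N → Witsenhausen.Sph n)
    (hx : ∀ i j, i ≠ j → x i ≠ x j ∧ x i ≠ -x j)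
    (q₁ : ℝ) (s : Finset (Fin N) → Finset (Fin N) → ℝ) (w₀ : ℝ) (w : Fin N → Fin N → ℝ)
    (hP : ∀ k : ℕ, Even k →
      1 ≤ w₀ * (Witsenhausen.gegenbauerP n k).eval 0
        + ∑ p : Fin N × Fin N with p.1 ≤ p.2,
            w p.1 p.2 * (Witsenhausen.gegenbauerP n k).eval
              (inner ℝ (x p.1 : EuclideanSpace ℝ (Fin n)) (x p.2 : EuclideanSpace ℝ (Fin n))))
    (hI : ∀ I : Finset (Fin N), (Witsenhausen.orthogonalityGraph x).IsIndepSet (I : Set (Fin N)) →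
      0 ≤ q₁
        - ∑ p : Fin N × Fin N with p.1 ≤ p.2 ∧ p.1 ∈ I ∧ p.2 ∈ I, w p.1 p.2
        + ∑ p : Finset (Fin N) × Finset (Fin N)
            with Witsenhausen.GeomCongruent x p.1 p.2 ∧ p.1 ⊆ I, s p.1 p.2
        - ∑ p : Finset (Fin N) × Finset (Fin N)
            with Witsenhausen.GeomCongruent x p.1 p.2 ∧ p.2 ⊆ I, s p.1 p.2) :
    Witsenhausen.alpha n ≤ q₁ := by
  open Witsenhausen in
  refine csSup_le ⟨0, ∅, MeasurableSet.empty.nullMeasurableSet, fun a ha => ha.elim, by simp⟩ ?_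
  rintro _ ⟨A, hA, hav, rfl⟩
  obtain ⟨B, hB, hneg, hBav, hle⟩ := exists_symmetric_measurable hA hav
  let z : Sph n := ⟨EuclideanSpace.single ⟨0, by omega⟩ 1, by simp⟩
  obtain ⟨e, he⟩ := exists_dot_eq_zero hn z
  have h1 := sum_mul_autocorrelation_le x hB hneg hBav q₁ s w hI
  set D : Finset (Fin N × Fin N) := Finset.univ.filter fun p => p.1 ≤ p.2
  -- The extra index `none` carries w₀ and the orthogonal pair z, e: it produces w₀ P_k(0) in the
  -- hypothesis and a vanishing autocorrelation in the conclusion.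
  have h2 := autocorrelation_self_le hn hB hneg (Finset.insertNone D)
    (fun o => o.elim w₀ fun p => w p.1 p.2) (fun o => o.elim z fun p => x p.1)
    (fun o => o.elim e fun p => x p.2) z (fun k hk => by
      rw [Finset.sum_insertNone]
      simpa [he] using hP k hk)
  rw [Finset.sum_insertNone] at h2
  simp only [Option.elim, autocorrelation_eq_zero hBav he, mul_zero, zero_add] at h2
  rw [autocorrelation_self hn hB] at h2
  exact (div_le_div_of_nonneg_right hle measureReal_nonneg).trans (h2.trans h1)
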